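/- Let $C$ be a locally presentable category with initial object $\emptyset$ and terminal object $*$, and let $(\mathcal L,\mathcal R)$ be a cofibrantly generated weak factorization system on $C$ (that is, $\mathcal R$ is the class of maps with the right lifting property against some small set of morphisms) such that $\emptyset\to X$ lies in $\mathcal L$ for every object $X$. For a class $S$ of morphisms, write $r(S)$ (resp. $l(S)$) for the class of maps with the right (resp. left) lifting property against $S$. Let $(I,\partial_0,\partial_1,\sigma)$ be a functorial cylinder on $C$: an endofunctor $I\colon C\to C$ with natural transformations $\partial_0,\partial_1\colon \mathrm{id}_C\Rightarrow I$ and $\sigma\colon I\Rightarrow \mathrm{id}_C$ such that $\sigma\partial_0=\sigma\partial_1=\mathrm{id}$ and $(\partial_0,\partial_1)\colon X\sqcup X\to I X$ is in $\mathcal L$ for every $X$. For a morphism $i\colon K\to L$ let \[ \partial I\boxtimes i\colon (L\sqcup L)\sqcup_{K\sqcup K} IK\to IL,\qquad \partial_\varepsilon\boxtimes i\colon L\sqcup_{K,\partial_\varepsilon} IK\to IL\quad(\varepsilon=0,1) \] be the maps induced on the pushouts. Assume that the cylinder is exact: $I$ preserves small colimits, and for every $i\in\mathcal L$ the maps $\partial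 I\boxtimes i$, $\partial_0\boxtimes i$ and $\partial_1\boxtimes i$ are in $\mathcal L$. Let $An^r(I)\subseteq\mathcal L$ be a class of right $I$-anodyne extensions, i.e. a class of morphisms such that (a) $An^r(I)=l(r(\Lambda))$ for some small set of morphisms $\Lambda\subseteq\mathcal L$; (b) $\partial_1\boxtimes i\in An^r(I)$ for every $i\in\mathcal L$; (c) $\partial I\boxtimes i\in An^r(I)$ for every $i\in An^r(I)$. A right $I$-fibration is a morphism with the right lifting property against $An^r(I)$, and an object $W$ is right $I$-fibrant if $W\to *$ is a right $I$-fibration. An $I$-homotopy from $f$ to $g\colon X\to Y$ is a morphism $h\colon IX\to Y$ with $h\,\partial_0=f$ and $h\,\partial_1=g$; $[X,Y]_I$ denotes the quotient of $\mathrm{Hom}_C(X,Y)$ by the equivalence relation generated by $I$-homotopy. Then there exists a unique model structure on $C$ such that (1) the class of cofibrations is $\mathcal L$; (2) a morphism $f\colon A\to B$ is a weak equivalence if and only if for every right $I$-fibrant object $W$ the induced map $f^*\colon[B,W]_I\to[A,W]_I$ is bijective. Furthermore, in this model structure an object is fibrant if and only if it is right $I$-fibrant, and a morphism between right $I$-fibrant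 objects is a fibration if and only if it is a right $I$-fibration. -/

import Mathlib

open CategoryTheory Limits HomotopicalAlgebra

universe v u

namespace DirectedCylinder

section LocallyPresentable

variable {C : Type u} [Category.{v} C]

theorem hasColimits_of_isLocallyPresentable [IsLocallyPresentable.{v} C] : HasColimits C := by
  obtain ⟨κ, _, _⟩ := IsLocallyPresentable.exists_cardinal.{v} C
  infer_instance

theorem hasLimits_of_isLocallyPresentable [IsLocallyPresentable.{v} C] : HasLimits C := by
  obtain ⟨κ, _, _⟩ := IsLocallyPresentable.exists_cardinal.{v} C
  let A := (equivSmallModel.{v} (isCardinalPresentable C κ).FullSubcategory).inverse ⋙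
    (isCardinalPresentable C κ).ι
  let N := Presheaf.restrictedULiftYoneda.{v} A
  let _ : Reflective N :=
    { L := uliftYoneda.{v}.leftKanExtension A
      adj := Presheaf.uliftYonedaAdjunction.{v} _ (uliftYoneda.{v}.leftKanExtensionUnit A) }
  exact hasLimits_of_reflective N

instance [IsLocallyPresentable.{v} C] : HasPushouts C :=
  have := hasColimits_of_isLocallyPresentable (C := C); inferInstance

instance [IsLocallyPresentable.{v} C] : HasBinaryCoproducts C :=
  have := hasColimits_of_isLocallyPresentable (C := C); inferInstance

instance [IsLocallyPresentable.{v} C] : HasInitial C :=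
  have := hasColimits_of_isLocallyPresentable (C := C); inferInstance

instance [IsLocallyPresentable.{v} C] : HasTerminal C :=
  have := hasLimits_of_isLocallyPresentable (C := C); inferInstance

end LocallyPresentable

section Cylinders

variable {C : Type u} [Category.{v} C]

/-- The weak factorization system `(L, R)` is cofibrantly generated: the class `R` consists of
the maps with the right lifting property against some small set of morphisms. -/
structure IsCofibrantlyGeneratedWFS (L R : MorphismProperty C) : Prop where
  isWFS : L.IsWeakFactorizationSystem R
  exists_generators : ∃ S : MorphismProperty C, MorphismProperty.IsSmall.{v} S ∧ S.rlp = R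

/-- A functorial cylinder object on `C`, relative to the left class `L`
of a weak factorization system. -/
structure FunctorialCylinder [HasBinaryCoproducts C] (L : MorphismProperty C) where
  /-- the cylinder endofunctor -/
  I : C ⥤ C
  /-- the inclusion of the end `{0}` -/
  d₀ : 𝟭 C ⟶ I
  /-- the inclusion of the end `{1}` -/
  d₁ : 𝟭 C ⟶ I
  /-- the projection -/
  σ : I ⟶ 𝟭 C
  d₀_σ : d₀ ≫ σ = 𝟙 (𝟭 C)
  d₁_σ : d₁ ≫ σ = 𝟙 (𝟭 C)
  boundary_mem (X : C) : L (coprod.desc (d₀.app X) (d₁.app X) : X ⨿ X ⟶ I.obj X)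

namespace FunctorialCylinder

section Homotopy

variable [HasBinaryCoproducts C] {L : MorphismProperty C} (cyl : FunctorialCylinder L)

/-- The map `∂I ⊗ X = X ⨿ X ⟶ I ⊗ X` induced by both ends. -/
noncomputable def boundary (X : C) : X ⨿ X ⟶ cyl.I.obj X :=
  coprod.desc (cyl.d₀.app X) (cyl.d₁.app X)

theorem boundary_naturality {K K' : C} (i : K ⟶ K') :
    coprod.map i i ≫ cyl.boundary K' = cyl.boundary K ≫ cyl.I.map i := by
  have h₀ := cyl.d₀.naturality i
  have h₁ := cyl.d₁.naturality i
  dsimp at h₀ h₁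
  apply coprod.hom_ext <;> simp [boundary, h₀, h₁]

/-- There is an `I`-homotopy from `f` to `g`. -/
def Homotopic {X Y : C} (f g : X ⟶ Y) : Prop :=
  ∃ h : cyl.I.obj X ⟶ Y, cyl.d₀.app X ≫ h = f ∧ cyl.d₁.app X ≫ h = g

theorem Homotopic.precomp {A B W : C} (f : A ⟶ B) {g g' : B ⟶ W}
    (H : cyl.Homotopic g g') : cyl.Homotopic (f ≫ g) (f ≫ g') := by
  obtain ⟨h, rfl, rfl⟩ := H
  have h₀ := cyl.d₀.naturality f
  have h₁ := cyl.d₁.naturality f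
  dsimp at h₀ h₁
  exact ⟨cyl.I.map f ≫ h, by rw [← Category.assoc, ← h₀, Category.assoc],
    by rw [← Category.assoc, ← h₁, Category.assoc]⟩

/-- The set `[X, Y]_I`. (`Quot r` is the quotient by the equivalence relation generated
by `r`.) -/
def HomotopyClasses (X Y : C) : Type v :=
  Quot (fun f g : X ⟶ Y => cyl.Homotopic f g)

/-- The map `f^* : [B, W]_I → [A, W]_I`. -/
def precomp {A B : C} (f : A ⟶ B) (W : C) :
    cyl.HomotopyClasses B W → cyl.HomotopyClasses A W :=
  Quot.map (fun g => f ≫ g) (fun _ _ H => Homotopic.precomp cyl f H)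

end Homotopy

section Box

variable [HasBinaryCoproducts C] [HasPushouts C] {L : MorphismProperty C}
  (cyl : FunctorialCylinder L)

/-- `∂I ⊠ i : (∂I ⊗ K') ⨿_{∂I ⊗ K} (I ⊗ K) ⟶ I ⊗ K'`. -/
noncomputable def boxBoundary {K K' : C} (i : K ⟶ K') :
    pushout (coprod.map i i) (cyl.boundary K) ⟶ cyl.I.obj K' :=
  pushout.desc (cyl.boundary K') (cyl.I.map i) (cyl.boundary_naturality i)

/-- `∂₀ ⊠ i : ({0} ⊗ K') ⨿_{{0} ⊗ K} (I ⊗ K) ⟶ I ⊗ K'`. -/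
noncomputable def box₀ {K K' : C} (i : K ⟶ K') :
    pushout i (cyl.d₀.app K) ⟶ cyl.I.obj K' :=
  pushout.desc (cyl.d₀.app K') (cyl.I.map i) (cyl.d₀.naturality i)

/-- `∂₁ ⊠ i : ({1} ⊗ K') ⨿_{{1} ⊗ K} (I ⊗ K) ⟶ I ⊗ K'`. -/
noncomputable def box₁ {K K' : C} (i : K ⟶ K') :
    pushout i (cyl.d₁.app K) ⟶ cyl.I.obj K' :=
  pushout.desc (cyl.d₁.app K') (cyl.I.map i) (cyl.d₁.naturality i)

/-- The functorial cylinder is exact. -/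
structure IsExact : Prop where
  preservesColimits : PreservesColimits cyl.I
  boxBoundary_mem {K K' : C} (j : K ⟶ K') : L j → L (cyl.boxBoundary j)
  box₀_mem {K K' : C} (j : K ⟶ K') : L j → L (cyl.box₀ j)
  box₁_mem {K K' : C} (j : K ⟶ K') : L j → L (cyl.box₁ j)

/-- `An` is a class of right `I`-anodyne extensions. -/
structure IsRightAnodyneClass (An : MorphismProperty C) : Prop where
  le : An ≤ L
  exists_generators : ∃ Λ : MorphismProperty C,
    MorphismProperty.IsSmall.{v} Λ ∧ Λ ≤ L ∧ An = Λ.rlp.llp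
  box₁_mem {K K' : C} (i : K ⟶ K') : L i → An (cyl.box₁ i)
  boxBoundary_mem {K K' : C} (i : K ⟶ K') : An i → An (cyl.boxBoundary i)

end Box

end FunctorialCylinder

/-- Right `I`-fibrations, for the class `An` of right `I`-anodyne extensions. -/
def rightFibrations (An : MorphismProperty C) : MorphismProperty C := An.rlp

/-- Right `I`-fibrant objects, for the class `An` of right `I`-anodyne extensions. -/
def IsRightFibrant [HasTerminal C] (An : MorphismProperty C) (W : C) : Prop :=
  rightFibrations An (terminal.from W)

/-- The maps `f : A ⟶ B` such that `f^* : [B, W]_I → [A, W]_I` is bijective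
for every right `I`-fibrant object `W`. -/
def rightEquivalences [HasBinaryCoproducts C] [HasTerminal C] {L : MorphismProperty C}
    (cyl : FunctorialCylinder L) (An : MorphismProperty C) : MorphismProperty C :=
  fun _ _ f => ∀ W : C, IsRightFibrant An W → Function.Bijective (cyl.precomp f W)

end Cylinders

end DirectedCylinder

/-! ### Homotopies and liftings along the cylinder. -/

namespace DirectedCylinder

variable {C : Type u} [Category.{v} C]

/-! Write W for the right equivalences. Filling open boxes shows that homotopy of maps into a right
fibrant object is already an equivalence relation, so a bijection on classes yields actual
homotopies. If a right fibration between right fibrant objects lies in W, these homotopies can be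
rectified into a section and a deformation over the base. Dragging a lifting problem along the
deformation shows that the map is in r(L) (`rlp_of_rightEquivalences`). Factorizations and retracts
then identify the maps of L ∩ W as those maps of L that lift against right fibrations between right
fibrant objects (`rightEquivalences_iff`). Hence L ∩ W is of the form l(-), and between right
fibrant objects the maps in r(L ∩ W) are exactly the right fibrations.

The remaining point is that (L ∩ W, r(L ∩ W)) admits factorizations. By Smith's argument
(`SolutionSetCondition.hasFactorization`) it suffices that maps of arrows from generators of L to
members of W factor through a small set of members of W. A small object argument in the arrow
category gives an accessible functor Φ and a natural map f ⟶ Φ f with anodyne components, where Φ f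
is a right fibration between right fibrant objects. So f is in W iff Φ f is in r(L), and this is
injectivity of Φ f against a small family of arrows. A Löwenheim–Skolem closure argument
(`exists_solutionSet`) bounds the size of the objects needed. -/

/-- Lifting problems for a map out of a pushout. -/
lemma exists_lift_pushout_desc {K K' J J' Z Y : C} {i : K ⟶ K'} {j : K ⟶ J}
    [HasPushout i j] {a : K' ⟶ J'} {b : J ⟶ J'} {w : i ≫ a = j ≫ b} {q : Z ⟶ Y}
    (hq : HasLiftingProperty (pushout.desc a b w) q) (s : K' ⟶ Z) (h : J ⟶ Z) (t : J' ⟶ Y)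
    (w' : i ≫ s = j ≫ h) (hs : a ≫ t = s ≫ q) (hh : b ≫ t = h ≫ q) :
    ∃ H : J' ⟶ Z, a ≫ H = s ∧ b ≫ H = h ∧ H ≫ q = t := by
  have sq : CommSq (pushout.desc s h w') (pushout.desc a b w) q t := ⟨by
    apply pushout.hom_ext
    · rw [pushout.inl_desc_assoc, pushout.inl_desc_assoc, hs]
    · rw [pushout.inr_desc_assoc, pushout.inr_desc_assoc, hh]⟩
  refine ⟨sq.lift, ?_, ?_, sq.fac_right⟩
  · exact (pushout.inl_desc_assoc _ _ _ _).symm.trans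
      ((pushout.inl i j ≫= sq.fac_left).trans (pushout.inl_desc s h w'))
  · exact (pushout.inr_desc_assoc _ _ _ _).symm.trans
      ((pushout.inr i j ≫= sq.fac_left).trans (pushout.inr_desc s h w'))

namespace FunctorialCylinder

section Naturality

variable [HasBinaryCoproducts C] {L : MorphismProperty C} (cyl : FunctorialCylinder L)

/-- The inclusion of the end `0` in the cylinder of `X`. -/
def i₀ (X : C) : X ⟶ cyl.I.obj X := cyl.d₀.app X

/-- The inclusion of the end `1` in the cylinder of `X`. -/
def i₁ (X : C) : X ⟶ cyl.I.obj X := cyl.d₁.app X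

/-- The projection from the cylinder of `X`. -/
def π (X : C) : cyl.I.obj X ⟶ X := cyl.σ.app X

lemma i₀_naturality {X Y : C} (f : X ⟶ Y) :
    f ≫ cyl.i₀ Y = cyl.i₀ X ≫ cyl.I.map f :=
  cyl.d₀.naturality f

lemma i₁_naturality {X Y : C} (f : X ⟶ Y) :
    f ≫ cyl.i₁ Y = cyl.i₁ X ≫ cyl.I.map f :=
  cyl.d₁.naturality f

lemma π_naturality {X Y : C} (f : X ⟶ Y) :
    cyl.I.map f ≫ cyl.π Y = cyl.π X ≫ f :=
  cyl.σ.naturality f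

@[simp]
lemma i₀_π (X : C) : cyl.i₀ X ≫ cyl.π X = 𝟙 X :=
  NatTrans.congr_app cyl.d₀_σ X

@[simp]
lemma i₁_π (X : C) : cyl.i₁ X ≫ cyl.π X = 𝟙 X :=
  NatTrans.congr_app cyl.d₁_σ X

lemma i₀_naturality_assoc {X Y Z : C} (f : X ⟶ Y) (g : cyl.I.obj Y ⟶ Z) :
    f ≫ cyl.i₀ Y ≫ g = cyl.i₀ X ≫ cyl.I.map f ≫ g := by
  rw [← Category.assoc, i₀_naturality, Category.assoc]

lemma i₁_naturality_assoc {X Y Z : C} (f : X ⟶ Y) (g : cyl.I.obj Y ⟶ Z) :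
    f ≫ cyl.i₁ Y ≫ g = cyl.i₁ X ≫ cyl.I.map f ≫ g := by
  rw [← Category.assoc, i₁_naturality, Category.assoc]

lemma π_naturality_assoc {X Y Z : C} (f : X ⟶ Y) (g : Y ⟶ Z) :
    cyl.I.map f ≫ cyl.π Y ≫ g = cyl.π X ≫ f ≫ g := by
  rw [← Category.assoc, π_naturality, Category.assoc]

@[simp]
lemma i₀_π_assoc {X Z : C} (f : X ⟶ Z) : cyl.i₀ X ≫ cyl.π X ≫ f = f := by
  rw [← Category.assoc, i₀_π, Category.id_comp]

@[simp]
lemma i₁_π_assoc {X Z : C} (f : X ⟶ Z) : cyl.i₁ X ≫ cyl.π X ≫ f = f := by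
  rw [← Category.assoc, i₁_π, Category.id_comp]

lemma boundary_eq (X : C) : cyl.boundary X = coprod.desc (cyl.i₀ X) (cyl.i₁ X) := rfl

variable {cyl}

lemma Homotopic.mk {X Y : C} {f g : X ⟶ Y} (h : cyl.I.obj X ⟶ Y) (h₀ : cyl.i₀ X ≫ h = f)
    (h₁ : cyl.i₁ X ≫ h = g) : cyl.Homotopic f g :=
  ⟨h, h₀, h₁⟩

lemma Homotopic.exists_hom {X Y : C} {f g : X ⟶ Y} (H : cyl.Homotopic f g) :
    ∃ h : cyl.I.obj X ⟶ Y, cyl.i₀ X ≫ h = f ∧ cyl.i₁ X ≫ h = g :=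
  H

variable (cyl) in
lemma Homotopic.refl {X Y : C} (f : X ⟶ Y) : cyl.Homotopic f f :=
  .mk (cyl.π X ≫ f) (by simp) (by simp)

lemma Homotopic.postcomp {X Y Z : C} {f g : X ⟶ Y} (H : cyl.Homotopic f g) (p : Y ⟶ Z) :
    cyl.Homotopic (f ≫ p) (g ≫ p) := by
  obtain ⟨h, rfl, rfl⟩ := H.exists_hom
  exact .mk (h ≫ p) (by simp) (by simp)

variable (cyl)

lemma precomp_comp {X Y Z : C} (f : X ⟶ Y) (g : Y ⟶ Z) (W : C) :
    cyl.precomp (f ≫ g) W = cyl.precomp f W ∘ cyl.precomp g W := by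
  ext ⟨h⟩
  exact congr_arg (Quot.mk _) (Category.assoc f g h)

lemma precomp_id (X W : C) : cyl.precomp (𝟙 X) W = id := by
  ext ⟨h⟩
  exact congr_arg (Quot.mk _) (Category.id_comp h)

lemma precomp_eq_of_homotopic {X Y : C} {f g : X ⟶ Y} (H : cyl.Homotopic f g) (W : C) :
    cyl.precomp f W = cyl.precomp g W := by
  ext ⟨h⟩
  exact Quot.sound (H.postcomp h)

end Naturality

section Lifting

variable [HasBinaryCoproducts C] [HasPushouts C] {L : MorphismProperty C}
  {cyl : FunctorialCylinder L} {An : MorphismProperty C}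

/-- Right fibrations lift homotopies whose end at `1` is prescribed. -/
lemma IsRightAnodyneClass.exists_lift_box₁ (hAn : cyl.IsRightAnodyneClass An)
    {Z Y : C} {q : Z ⟶ Y} (hq : An.rlp q) {K K' : C} {i : K ⟶ K'} (hi : L i)
    (s : K' ⟶ Z) (h : cyl.I.obj K ⟶ Z) (b : cyl.I.obj K' ⟶ Y)
    (w : i ≫ s = cyl.i₁ K ≫ h) (hs : cyl.i₁ K' ≫ b = s ≫ q)
    (hh : cyl.I.map i ≫ b = h ≫ q) :
    ∃ H : cyl.I.obj K' ⟶ Z, cyl.i₁ K' ≫ H = s ∧ cyl.I.map i ≫ H = h ∧ H ≫ q = b := by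
  exact exists_lift_pushout_desc (hq _ (hAn.box₁_mem i hi)) s h b w hs hh

/-- Anodyne extensions extend homotopies with prescribed ends. -/
lemma IsRightAnodyneClass.exists_lift_boxBoundary (hAn : cyl.IsRightAnodyneClass An)
    {Z Y : C} {q : Z ⟶ Y} (hq : An.rlp q) {K K' : C} {i : K ⟶ K'} (hi : An i)
    (s₀ s₁ : K' ⟶ Z) (h : cyl.I.obj K ⟶ Z) (b : cyl.I.obj K' ⟶ Y)
    (w₀ : i ≫ s₀ = cyl.i₀ K ≫ h) (w₁ : i ≫ s₁ = cyl.i₁ K ≫ h)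
    (hs₀ : cyl.i₀ K' ≫ b = s₀ ≫ q) (hs₁ : cyl.i₁ K' ≫ b = s₁ ≫ q)
    (hh : cyl.I.map i ≫ b = h ≫ q) :
    ∃ H : cyl.I.obj K' ⟶ Z, cyl.i₀ K' ≫ H = s₀ ∧ cyl.i₁ K' ≫ H = s₁ ∧
      cyl.I.map i ≫ H = h ∧ H ≫ q = b := by
  obtain ⟨H, hH, hH', hHq⟩ := exists_lift_pushout_desc (hq _ (hAn.boxBoundary_mem i hi))
    (coprod.desc s₀ s₁) h b (by apply coprod.hom_ext <;> simp [boundary_eq, w₀, w₁])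
    (by apply coprod.hom_ext <;> simp [boundary_eq, hs₀, hs₁]) hh
  refine ⟨H, ?_, ?_, hH', hHq⟩
  · rw [← coprod.inl_desc s₀ s₁, ← hH, boundary_eq, coprod.inl_desc_assoc]
  · rw [← coprod.inr_desc s₀ s₁, ← hH, boundary_eq, coprod.inr_desc_assoc]

/-- Right fibrations lift homotopies along the end at `1`. -/
lemma IsRightAnodyneClass.exists_lift_i₁ [HasInitial C] (hcyl : cyl.IsExact)
    (hAn : cyl.IsRightAnodyneClass An) {Z Y : C} {q : Z ⟶ Y} (hq : An.rlp q) {X : C}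
    (hX : L (initial.to X)) (s : X ⟶ Z) (b : cyl.I.obj X ⟶ Y)
    (hs : cyl.i₁ X ≫ b = s ≫ q) :
    ∃ H : cyl.I.obj X ⟶ Z, cyl.i₁ X ≫ H = s ∧ H ≫ q = b := by
  have := hcyl.preservesColimits
  -- Since I preserves the initial object, lifting against the box of ∅ ⟶ X is lifting against the
  -- end 1 of X.
  have hI : IsInitial (cyl.I.obj (⊥_ C)) := initialIsInitial.isInitialObj cyl.I
  obtain ⟨H, h₁, -, h₂⟩ := hAn.exists_lift_box₁ hq hX s (hI.to Z) b
    (initialIsInitial.hom_ext _ _) hs (hI.hom_ext _ _)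
  exact ⟨H, h₁, h₂⟩

lemma IsExact.exists_desc_map_coprod (hcyl : cyl.IsExact) {X Z : C}
    (h₀ h₁ : cyl.I.obj X ⟶ Z) :
    ∃ h : cyl.I.obj (X ⨿ X) ⟶ Z, cyl.I.map coprod.inl ≫ h = h₀ ∧
      cyl.I.map coprod.inr ≫ h = h₁ := by
  have := hcyl.preservesColimits
  have hc := mapIsColimitOfPreservesOfIsColimit cyl.I (coprod.inl : X ⟶ X ⨿ X) coprod.inr
    (coprodIsCoprod X X)
  obtain ⟨h, hh₀, hh₁⟩ := BinaryCofan.IsColimit.desc' hc h₀ h₁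
  exact ⟨h, hh₀, hh₁⟩

lemma IsExact.map_coprod_hom_ext (hcyl : cyl.IsExact) {X Z : C}
    {h h' : cyl.I.obj (X ⨿ X) ⟶ Z}
    (e₀ : cyl.I.map coprod.inl ≫ h = cyl.I.map coprod.inl ≫ h')
    (e₁ : cyl.I.map coprod.inr ≫ h = cyl.I.map coprod.inr ≫ h') : h = h' := by
  have := hcyl.preservesColimits
  exact BinaryCofan.IsColimit.hom_ext (mapIsColimitOfPreservesOfIsColimit cyl.I
    (coprod.inl : X ⟶ X ⨿ X) coprod.inr (coprodIsCoprod X X)) e₀ e₁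

/-- Given three sides of a square of homotopies, a right fibration allows to fill in
the fourth side. -/
lemma IsRightAnodyneClass.exists_filler (hcyl : cyl.IsExact)
    (hAn : cyl.IsRightAnodyneClass An) {Z Y : C} {q : Z ⟶ Y} (hq : An.rlp q) {X : C}
    (h₀ h₁ k : cyl.I.obj X ⟶ Z) (b : cyl.I.obj (cyl.I.obj X) ⟶ Y)
    (w₀ : cyl.i₁ X ≫ h₀ = cyl.i₀ X ≫ k) (w₁ : cyl.i₁ X ≫ h₁ = cyl.i₁ X ≫ k)
    (hb₀ : cyl.I.map (cyl.i₀ X) ≫ b = h₀ ≫ q)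
    (hb₁ : cyl.I.map (cyl.i₁ X) ≫ b = h₁ ≫ q)
    (hb : cyl.i₁ (cyl.I.obj X) ≫ b = k ≫ q) :
    ∃ l : cyl.I.obj X ⟶ Z, cyl.i₀ X ≫ l = cyl.i₀ X ≫ h₀ ∧
      cyl.i₁ X ≫ l = cyl.i₀ X ≫ h₁ ∧
      l ≫ q = cyl.i₀ (cyl.I.obj X) ≫ b := by
  obtain ⟨h, hh₀, hh₁⟩ := hcyl.exists_desc_map_coprod h₀ h₁
  -- The boundary of X is itself in L, and I(X ⨿ X) is a coproduct of two copies of IX. Its box is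
  -- thus a square without the side at the outer end 0, which is read off from the filler.
  obtain ⟨H, hH₁, hH, hHq⟩ := hAn.exists_lift_box₁ (i := cyl.boundary X) hq
    (cyl.boundary_mem X) k h b
    (by
      apply coprod.hom_ext
      · rw [i₁_naturality_assoc, hh₀, boundary_eq, coprod.inl_desc_assoc, w₀]
      · rw [i₁_naturality_assoc, hh₁, boundary_eq, coprod.inr_desc_assoc, w₁]) hb
    (by
      apply hcyl.map_coprod_hom_ext
      · rw [← Functor.map_comp_assoc, reassoc_of% hh₀, boundary_eq, coprod.inl_desc, hb₀]
      · rw [← Functor.map_comp_assoc, reassoc_of% hh₁, boundary_eq, coprod.inr_desc, hb₁])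
  have e₀ : cyl.I.map (cyl.i₀ X) ≫ H = h₀ := by
    rw [← hh₀, ← hH, ← Functor.map_comp_assoc, boundary_eq, coprod.inl_desc]
  have e₁ : cyl.I.map (cyl.i₁ X) ≫ H = h₁ := by
    rw [← hh₁, ← hH, ← Functor.map_comp_assoc, boundary_eq, coprod.inr_desc]
  refine ⟨cyl.i₀ (cyl.I.obj X) ≫ H, ?_, ?_, ?_⟩
  · rw [i₀_naturality_assoc, e₀]
  · rw [i₀_naturality_assoc, e₁]
  · rw [Category.assoc, hHq]

end Lifting

end FunctorialCylinder

end DirectedCylinder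

/-! ### Right equivalences and right fibrations between right fibrant objects. -/

namespace DirectedCylinder

variable {C : Type u} [Category.{v} C]

section

variable [HasBinaryCoproducts C] [HasTerminal C] {L : MorphismProperty C}
  (cyl : FunctorialCylinder L) (An : MorphismProperty C)

instance : (rightEquivalences cyl An).HasTwoOutOfThreeProperty where
  comp_mem f g hf hg W hW := by
    rw [cyl.precomp_comp]
    exact (hf W hW).comp (hg W hW)
  of_postcomp f g hg hfg W hW := by
    have := hfg W hW
    rw [cyl.precomp_comp] at this
    exact (Function.Bijective.of_comp_iff _ (hg W hW)).1 this
  of_precomp f g hf hfg W hW := by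
    have := hfg W hW
    rw [cyl.precomp_comp] at this
    exact (Function.Bijective.of_comp_iff' (hf W hW) _).1 this

/-- A part of the two-out-of-six property of right equivalences. -/
lemma rightEquivalences_of_comp_of_comp {X Y Z T : C} {f : X ⟶ Y} {g : Y ⟶ Z} {h : Z ⟶ T}
    (hfg : rightEquivalences cyl An (f ≫ g)) (hgh : rightEquivalences cyl An (g ≫ h)) :
    rightEquivalences cyl An f := by
  suffices hg : rightEquivalences cyl An g from MorphismProperty.of_postcomp _ f g hg hfg
  intro W hW
  have h₁ := hfg W hW
  have h₂ := hgh W hW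
  rw [cyl.precomp_comp] at h₁ h₂
  exact ⟨h₁.injective.of_comp, h₂.surjective.of_comp⟩

variable {cyl} in
lemma rightEquivalences_of_homotopy_inverse {X Y : C} {f : X ⟶ Y} {g : Y ⟶ X}
    (hfg : cyl.Homotopic (f ≫ g) (𝟙 X)) (hgf : cyl.Homotopic (g ≫ f) (𝟙 Y)) :
    rightEquivalences cyl An f := fun W _ ↦ by
  have h₁ := cyl.precomp_eq_of_homotopic hfg W
  have h₂ := cyl.precomp_eq_of_homotopic hgf W
  rw [cyl.precomp_comp, cyl.precomp_id] at h₁ h₂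
  exact Function.bijective_iff_has_inverse.2
    ⟨cyl.precomp g W, congr_fun h₂, congr_fun h₁⟩

/-- Such a map p is a homotopy equivalence: lifting against ∅ ⟶ Y gives a section s, and lifting
against the boundary of X gives a homotopy from p ≫ s to the identity. -/
lemma FunctorialCylinder.rlp_le_rightEquivalences [HasInitial C] {cyl : FunctorialCylinder L}
    {An : MorphismProperty C}
    (hcof : ∀ X : C, L (initial.to X)) :
    L.rlp ≤ rightEquivalences cyl An := by
  intro X Y p hp
  have := hp _ (hcof Y)
  have sq : CommSq (initial.to X) (initial.to Y) p (𝟙 Y) := ⟨by simp⟩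
  have : HasLiftingProperty (coprod.desc (cyl.i₀ X) (cyl.i₁ X)) p :=
    hp _ (cyl.boundary_mem X)
  have sq' : CommSq (coprod.desc (p ≫ sq.lift) (𝟙 X)) (coprod.desc (cyl.i₀ X) (cyl.i₁ X)) p
      (cyl.π X ≫ p) := ⟨by apply coprod.hom_ext <;> simp⟩
  have fac := sq'.fac_left
  refine rightEquivalences_of_homotopy_inverse An (g := sq.lift)
    (.mk sq'.lift ?_ ?_) (by rw [sq.fac_right]; exact .refl _ _)
  · rw [← coprod.inl_desc_assoc (cyl.i₀ X) (cyl.i₁ X), fac, coprod.inl_desc]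
  · rw [← coprod.inr_desc_assoc (cyl.i₀ X) (cyl.i₁ X), fac, coprod.inr_desc]

end

namespace FunctorialCylinder

variable [HasBinaryCoproducts C] [HasPushouts C] [HasTerminal C]
  {L : MorphismProperty C} {cyl : FunctorialCylinder L} {An : MorphismProperty C}

/-- Only the end 1 can be filled, so homotopies are a priori directed. This open square with
constant sides gives symmetry and transitivity at once. -/
lemma IsRightAnodyneClass.homotopic_of_square
    (hcyl : cyl.IsExact) (hAn : cyl.IsRightAnodyneClass An) {W : C}
    (hW : IsRightFibrant An W)
    {X : C} {a b c d : X ⟶ W}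
    (hab : cyl.Homotopic a b) (hcd : cyl.Homotopic c d) (hbd : cyl.Homotopic b d) :
    cyl.Homotopic a c := by
  obtain ⟨h₀, rfl, rfl⟩ := hab.exists_hom
  obtain ⟨h₁, rfl, rfl⟩ := hcd.exists_hom
  obtain ⟨k, hk₀, hk₁⟩ := hbd.exists_hom
  obtain ⟨l, hl₀, hl₁, -⟩ := hAn.exists_filler hcyl hW h₀ h₁ k (terminal.from _)
    hk₀.symm hk₁.symm (by simp) (by simp) (by simp)
  exact .mk l hl₀ hl₁

lemma IsRightAnodyneClass.homotopic_equivalence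
    (hcyl : cyl.IsExact) (hAn : cyl.IsRightAnodyneClass An) {W : C}
    (hW : IsRightFibrant An W)
    (X : C) :
    Equivalence (fun f g : X ⟶ W ↦ cyl.Homotopic f g) where
  refl := Homotopic.refl cyl
  symm h := hAn.homotopic_of_square hcyl hW (.refl _ _) h (.refl _ _)
  trans h h' := hAn.homotopic_of_square hcyl hW h (.refl _ _) h'

lemma IsRightAnodyneClass.homotopic_of_mk_eq
    (hcyl : cyl.IsExact) (hAn : cyl.IsRightAnodyneClass An) {W : C}
    (hW : IsRightFibrant An W)
    {X : C} {f g : X ⟶ W}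
    (h : (Quot.mk _ f : cyl.HomotopyClasses X W) = Quot.mk _ g) : cyl.Homotopic f g :=
  (hAn.homotopic_equivalence hcyl hW X).eqvGen_iff.1 (Quot.eqvGen_exact h)

/-- Surjectivity extends maps along i. Injectivity extends homotopies with prescribed ends, which is
lifting against the boundary box of i, again anodyne. -/
lemma IsRightAnodyneClass.le_rightEquivalences
    (hcyl : cyl.IsExact) (hAn : cyl.IsRightAnodyneClass An) : An ≤ rightEquivalences cyl An := by
  intro A B i hi W hW
  constructor
  · rintro ⟨f⟩ ⟨g⟩ hfg
    obtain ⟨h, hh₀, hh₁⟩ := (hAn.homotopic_of_mk_eq hcyl hW hfg).exists_hom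
    obtain ⟨H, hH₀, hH₁, -, -⟩ := hAn.exists_lift_boxBoundary hW hi f g h (terminal.from _)
      hh₀.symm hh₁.symm (by simp) (by simp) (by simp)
    exact Quot.sound (.mk H hH₀ hH₁)
  · rintro ⟨f⟩
    have := hW _ hi
    have sq : CommSq f i (terminal.from W) (terminal.from B) := ⟨by simp⟩
    exact ⟨Quot.mk _ sq.lift, congr_arg (Quot.mk _) sq.fac_left⟩

section

variable [HasInitial C]

/-- A right fibration between right fibrant objects which is a right equivalence
admits a section and a fiberwise deformation onto this section. -/
lemma IsRightAnodyneClass.exists_fiberwise_deformation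
    (hcof : ∀ X : C, L (initial.to X)) (hcyl : cyl.IsExact)
    (hAn : cyl.IsRightAnodyneClass An)
    {X Y : C} {q : X ⟶ Y}
    (hq : An.rlp q) (hX : IsRightFibrant An X) (hY : IsRightFibrant An Y)
    (hw : rightEquivalences cyl An q) :
    ∃ (s : Y ⟶ X) (K : cyl.I.obj X ⟶ X), s ≫ q = 𝟙 Y ∧ cyl.i₀ X ≫ K = 𝟙 X ∧
      cyl.i₁ X ≫ K = q ≫ s ∧ K ≫ q = cyl.π X ≫ q := by
  -- Testing on X gives a homotopy inverse on one side; testing on Y shows that it is two-sided.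
  obtain ⟨⟨s⟩, hs⟩ := (hw X hX).surjective (Quot.mk _ (𝟙 X))
  replace hs : cyl.Homotopic (𝟙 X) (q ≫ s) := hAn.homotopic_of_mk_eq hcyl hX hs.symm
  have hsq : cyl.Homotopic (𝟙 Y) (s ≫ q) := hAn.homotopic_of_mk_eq hcyl hY
    ((hw Y hY).injective (Quot.sound (by simpa using hs.postcomp q)))
  obtain ⟨b, hb₀, hb₁⟩ := hsq.exists_hom
  -- The homotopy runs from 𝟙 to s ≫ q so that it can be lifted starting from s at the end 1; its
  -- end 0 is then a strict section.
  obtain ⟨H, hH, hHq⟩ := hAn.exists_lift_i₁ hcyl hq (hcof Y) s b hb₁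
  obtain ⟨s', hs'⟩ : ∃ s' : Y ⟶ X, cyl.i₀ Y ≫ H = s' := ⟨_, rfl⟩
  have hs'q : s' ≫ q = 𝟙 Y := by rw [← hs', Category.assoc, hHq, hb₀]
  have hss' : cyl.Homotopic s' s := .mk H hs' hH
  have equiv := hAn.homotopic_equivalence hcyl hX X
  obtain ⟨k, hk₀, hk₁⟩ := (equiv.trans hs (equiv.symm (hss'.precomp cyl q))).exists_hom
  -- Since s' ≫ q = 𝟙, the homotopies k and k ≫ q ≫ s' have the same image k ≫ q in Y. Opposing them
  -- in a square over I(π) ≫ k ≫ q leaves a fourth side over the constant homotopy.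
  obtain ⟨l, hl₀, hl₁, hlq⟩ := hAn.exists_filler hcyl hq k (k ≫ q ≫ s') (cyl.π X ≫ q ≫ s')
    (cyl.I.map (cyl.π X) ≫ k ≫ q) (by simp [hk₁]) (by simp [reassoc_of% hk₁, reassoc_of% hs'q])
    (by rw [← Functor.map_comp_assoc, i₀_π]; simp)
    (by rw [← Functor.map_comp_assoc, i₁_π]; simp [hs'q])
    (by rw [← i₁_naturality_assoc, reassoc_of% hk₁]; simp)
  exact ⟨s', l, hs'q, by rw [hl₀, hk₀], by rw [hl₁, reassoc_of% hk₀],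
    by rw [hlq, ← i₀_naturality_assoc, reassoc_of% hk₀]⟩

/-- A right fibration between right fibrant objects which is a right equivalence
has the right lifting property against the left class. -/
lemma IsRightAnodyneClass.rlp_of_rightEquivalences
    (hcof : ∀ X : C, L (initial.to X)) (hcyl : cyl.IsExact)
    (hAn : cyl.IsRightAnodyneClass An)
    {X Y : C} {q : X ⟶ Y}
    (hq : An.rlp q) (hX : IsRightFibrant An X) (hY : IsRightFibrant An Y)
    (hw : rightEquivalences cyl An q) : L.rlp q := by
  obtain ⟨s, K, hs, hK₀, hK₁, hKq⟩ :=
    hAn.exists_fiberwise_deformation hcof hcyl hq hX hY hw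
  intro A B i hi
  refine ⟨fun {u v} sq ↦ ?_⟩
  -- At the end 1 the problem is solved by v ≫ s, since u has been deformed to u ≫ q ≫ s. Lifting
  -- over the constant homotopy at v moves this solution back to the end 0, where u is restored.
  obtain ⟨H, -, hH, hHq⟩ := hAn.exists_lift_box₁ hq hi (v ≫ s) (cyl.I.map u ≫ K)
    (cyl.π B ≫ v) (by rw [← i₁_naturality_assoc, hK₁, sq.w_assoc]) (by simp [hs])
    (by rw [Category.assoc, hKq, π_naturality_assoc, π_naturality_assoc, sq.w])
  exact ⟨⟨{
    l := cyl.i₀ B ≫ H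
    fac_left := by rw [i₀_naturality_assoc, hH, ← i₀_naturality_assoc, hK₀, Category.comp_id]
    fac_right := by rw [Category.assoc, hHq, i₀_π_assoc] }⟩⟩

end

end FunctorialCylinder

/-- The right fibrations between right fibrant objects. -/
def rightFibrationsOfFibrant [HasTerminal C] (An : MorphismProperty C) : MorphismProperty C :=
  fun X Y p ↦ IsRightFibrant An X ∧ IsRightFibrant An Y ∧ rightFibrations An p

lemma IsRightFibrant.of_rightFibrations [HasTerminal C] {An : MorphismProperty C} {X Y : C}
    {p : X ⟶ Y} (hp : An.rlp p) (hY : IsRightFibrant An Y) : IsRightFibrant An X := by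
  have : An.rlp (p ≫ terminal.from Y) := MorphismProperty.comp_mem _ _ _ hp hY
  rwa [terminal.comp_from] at this

lemma isRightFibrant_terminal [HasTerminal C] (An : MorphismProperty C) :
    IsRightFibrant An (⊤_ C) := by
  have : terminal.from (⊤_ C) = 𝟙 _ := terminalIsTerminal.hom_ext _ _
  rw [IsRightFibrant, this]
  exact MorphismProperty.id_mem An.rlp _

lemma exists_isRightFibrant_of_hasFactorization [HasTerminal C] (An : MorphismProperty C)
    [An.HasFactorization An.rlp] (X : C) :
    ∃ (Y : C) (i : X ⟶ Y), An i ∧ IsRightFibrant An Y := by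
  let fac := MorphismProperty.factorizationData An An.rlp (terminal.from X)
  exact ⟨fac.Z, fac.i, fac.hi, .of_rightFibrations fac.hp (isRightFibrant_terminal _)⟩

namespace FunctorialCylinder

variable [HasBinaryCoproducts C] [HasPushouts C]
  {L : MorphismProperty C} {cyl : FunctorialCylinder L} {An : MorphismProperty C}

lemma IsRightAnodyneClass.rlp_llp (hAn : cyl.IsRightAnodyneClass An) : An.rlp.llp = An := by
  obtain ⟨Λ, _, _, rfl⟩ := hAn.exists_generators
  simp

variable [HasTerminal C] [HasInitial C] [An.HasFactorization An.rlp]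

/-- Retract argument: in a factorization of i into an anodyne map and a right fibration, the second
factor is a right equivalence between right fibrant objects, so i lifts against it. -/
lemma IsRightAnodyneClass.of_rightEquivalences
    (hcof : ∀ X : C, L (initial.to X)) (hcyl : cyl.IsExact)
    (hAn : cyl.IsRightAnodyneClass An)
    {A B : C} {i : A ⟶ B} (hi : L i)
    (hw : rightEquivalences cyl An i) (hB : IsRightFibrant An B) : An i := by
  let fac := MorphismProperty.factorizationData An An.rlp i
  have hp : rightEquivalences cyl An fac.p :=
    MorphismProperty.of_precomp _ fac.i fac.p (hAn.le_rightEquivalences hcyl _ fac.hi)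
      (by rwa [fac.fac])
  have := hAn.rlp_of_rightEquivalences hcof hcyl fac.hp (.of_rightFibrations fac.hp hB) hB hp i hi
  rw [← hAn.rlp_llp]
  exact MorphismProperty.of_retract (RetractArrow.ofLeftLiftingProperty fac.fac)
    (An.le_llp_rlp _ fac.hi)

variable [L.IsStableUnderComposition]

/-- The maps in the left class which are right equivalences are those which have the left
lifting property against right fibrations between right fibrant objects. -/
lemma IsRightAnodyneClass.rightEquivalences_iff
    (hcof : ∀ X : C, L (initial.to X)) (hcyl : cyl.IsExact)
    (hAn : cyl.IsRightAnodyneClass An)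
    {A B : C} {i : A ⟶ B} (hi : L i) :
    rightEquivalences cyl An i ↔ (rightFibrationsOfFibrant An).llp i := by
  obtain ⟨B', j, hj, hB'⟩ := exists_isRightFibrant_of_hasFactorization An B
  have hjw := hAn.le_rightEquivalences hcyl _ hj
  constructor
  · rintro hw X Y p ⟨hX, hY, hp⟩
    have hij : An (i ≫ j) := hAn.of_rightEquivalences hcof hcyl
      (L.comp_mem _ _ hi (hAn.le _ hj)) (MorphismProperty.comp_mem _ _ _ hw hjw) hB'
    refine ⟨fun {u v} sq ↦ ?_⟩
    have := hY _ hj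
    have sq₁ : CommSq v j (terminal.from Y) (terminal.from B') := ⟨by simp⟩
    have := hp _ hij
    have sq₂ : CommSq u (i ≫ j) p sq₁.lift := ⟨by simp [sq.w]⟩
    exact ⟨⟨{
      l := j ≫ sq₂.lift
      fac_left := by rw [← Category.assoc, sq₂.fac_left]
      fac_right := by rw [Category.assoc, sq₂.fac_right, sq₁.fac_left] }⟩⟩
  · intro hlift
    let fac := MorphismProperty.factorizationData An An.rlp (i ≫ j)
    have := hlift fac.p ⟨.of_rightFibrations fac.hp hB', hB', fac.hp⟩
    have sq : CommSq fac.i i fac.p j := ⟨fac.fac⟩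
    -- Two-out-of-six: both composites with the diagonal filler are the anodyne maps `fac.i` and
    -- `j`.
    refine rightEquivalences_of_comp_of_comp (g := sq.lift) (h := fac.p) _ _ ?_ ?_
    · rw [sq.fac_left]
      exact hAn.le_rightEquivalences hcyl _ fac.hi
    · rwa [sq.fac_right]

/-- The maps in the left class which are right equivalences form a class defined by a left
lifting property. -/
lemma IsRightAnodyneClass.inf_rightEquivalences_eq_llp
    (hcof : ∀ X : C, L (initial.to X)) (hcyl : cyl.IsExact)
    (hAn : cyl.IsRightAnodyneClass An)
    (hL : L.rlp.llp = L) :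
    L ⊓ rightEquivalences cyl An = (L.rlp ⊔ rightFibrationsOfFibrant An).llp := by
  ext A B i
  constructor
  · rintro ⟨hi, hw⟩ X Y p (hp | hp)
    · exact hp _ hi
    · exact (hAn.rightEquivalences_iff hcof hcyl hi).1 hw _ hp
  · intro h
    have hi : L i := by
      rw [← hL]
      exact fun _ _ _ hp ↦ h _ (Or.inl hp)
    exact ⟨hi, (hAn.rightEquivalences_iff hcof hcyl hi).2 fun _ _ _ hp ↦ h _ (Or.inr hp)⟩

end FunctorialCylinder

end DirectedCylinder

/-! ### Accessible weak reflections by the small object argument. -/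

namespace DirectedCylinder

section

variable {D : Type*} [Category* D] {E : Type*} [Category* E]

/-- A colimit of functors which preserve colimits of a given shape also preserves them. -/
lemma preservesColimitsOfShape_of_isColimit {K K' : Type*} [Category* K] [Category* K']
    [HasColimitsOfShape K' E] {F : K' ⥤ D ⥤ E} {c : Cocone F} (hc : IsColimit c)
    (hF : ∀ k, PreservesColimitsOfShape K (F.obj k)) : PreservesColimitsOfShape K c.pt := by
  have : PreservesColimitsOfShape K F.flip := ⟨fun {G} ↦ ⟨fun {d} hd ↦
    ⟨evaluationJointlyReflectsColimits _ (fun k ↦ isColimitOfPreserves (F.obj k) hd)⟩⟩⟩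
  let e : F.flip ⋙ colim ≅ c.pt :=
    NatIso.ofComponents (fun j ↦ (colimit.isColimit (F.flip.obj j)).coconePointUniqueUpToIso
      (isColimitOfPreserves ((evaluation _ _).obj j) hc)) (fun {X Y} f ↦ by
        apply colimit.hom_ext
        intro k
        simp)
  exact preservesColimitsOfShape_of_natIso e

end

namespace WeakReflection

section

variable {D : Type*} [Category* D] {ι : Type*} {A B : ι → D} (m : ∀ i, A i ⟶ B i)

/-- The object `X` is injective with respect to the family of morphisms `m`. -/
def IsInjective (X : D) : Prop :=
  ∀ (i : ι) (x : A i ⟶ X), ∃ y : B i ⟶ X, m i ≫ y = x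

variable {m} in
lemma IsInjective.of_iso {X Y : D} (hX : IsInjective m X) (e : X ≅ Y) : IsInjective m Y :=
  fun i x ↦ by
    obtain ⟨y, hy⟩ := hX i (x ≫ e.inv)
    exact ⟨y ≫ e.hom, by simp [reassoc_of% hy]⟩

end

variable {D : Type u} [Category.{v} D] [HasColimitsOfSize.{v, v} D]
  {ι : Type v} {A B : ι → D} (m : ∀ i, A i ⟶ B i)

variable (A) in
/-- The functor sending `X` to the coproduct of copies of `Z` indexed by `A i ⟶ X`. -/
noncomputable def cells (i : ι) (Z : D) : D ⥤ D :=
  coyoneda.obj (Opposite.op (A i)) ⋙ sigmaConst.{v}.obj Z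

/-- The morphism attaching copies of `m i`. -/
noncomputable def cellsMap (i : ι) : cells A i (A i) ⟶ cells A i (B i) :=
  Functor.whiskerLeft _ (sigmaConst.{v}.map (m i))

variable (A) in
/-- The attaching maps. -/
noncomputable def attach (i : ι) : cells A i (A i) ⟶ 𝟭 D :=
  (sigmaConstAdj (A i)).counit

/-- The inclusion of the summand indexed by `x`. -/
noncomputable def cellsι {i : ι} {X : D} (x : A i ⟶ X) (Z : D) : Z ⟶ (cells A i Z).obj X :=
  Sigma.ι (fun _ : A i ⟶ X ↦ Z) x

lemma cellsι_cellsMap {i : ι} {X : D} (x : A i ⟶ X) :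
    cellsι x (A i) ≫ (cellsMap m i).app X = m i ≫ cellsι x (B i) :=
  Limits.Sigma.ι_map (f := fun _ : A i ⟶ X ↦ A i) (fun _ ↦ m i) x

lemma cellsι_attach {i : ι} {X : D} (x : A i ⟶ X) :
    cellsι x (A i) ≫ (attach A i).app X = x :=
  Limits.Sigma.ι_desc (f := fun _ : A i ⟶ X ↦ A i) id x

/-- The functor which attaches all possible cells `m i` to an object. -/
noncomputable def step : D ⥤ D :=
  pushout (Limits.Sigma.map (cellsMap m)) (Limits.Sigma.desc (attach A))

/-- The inclusion of the cells in the object obtained by attaching cells. -/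
noncomputable def fromCells : (∐ fun i ↦ cells A i (B i)) ⟶ step m := pushout.inl _ _

/-- The inclusion of an object in the object obtained by attaching cells. -/
noncomputable def toStep : 𝟭 D ⟶ step m := pushout.inr _ _

lemma isPushout_step : IsPushout (Limits.Sigma.map (cellsMap m)) (Limits.Sigma.desc (attach A))
    (fromCells m) (toStep m) :=
  IsPushout.of_hasPushout _ _

lemma exists_extension_toStep (i : ι) {X : D} (x : A i ⟶ X) :
    ∃ y : B i ⟶ (step m).obj X, m i ≫ y = x ≫ (toStep m).app X := by
  have h : cellsMap m i ≫ Sigma.ι (fun i ↦ cells A i (B i)) i ≫ fromCells m =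
      attach A i ≫ toStep m := by
    have := Sigma.ι (fun i ↦ cells A i (A i)) i ≫= (isPushout_step m).w
    rwa [Limits.Sigma.ι_map_assoc, Limits.Sigma.ι_desc_assoc] at this
  have h' := cellsι x (A i) ≫= NatTrans.congr_app h X
  simp only [NatTrans.comp_app] at h'
  refine ⟨cellsι x (B i) ≫ (Sigma.ι (fun i ↦ cells A i (B i)) i).app X ≫
    (fromCells m).app X, ?_⟩
  rw [← Category.assoc, ← cellsι_cellsMap, Category.assoc, h', ← Category.assoc, cellsι_attach]

lemma llp_rlp_toStep : ((MorphismProperty.ofHoms m).rlp.llp.functorCategory D) (toStep m) := by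
  refine MorphismProperty.of_isPushout (isPushout_step m).flip
    (MorphismProperty.colimMap _ (fun ⟨i⟩ X ↦ ?_))
  have h : (MorphismProperty.ofHoms m).rlp.llp (m i) := MorphismProperty.le_llp_rlp _ _ ⟨i⟩
  exact MorphismProperty.colimMap (W := (MorphismProperty.ofHoms m).rlp.llp)
    (Discrete.natTrans (F := Discrete.functor fun _ : A i ⟶ X ↦ A i)
      (G := Discrete.functor fun _ : A i ⟶ X ↦ B i) (fun _ ↦ m i)) (fun _ ↦ h)

/-- Hom(A i, -) preserves κ-filtered colimits, and the copower functor of Z is a left adjoint. -/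
lemma preservesColimitsOfShape_cells (κ : Cardinal.{v}) [Fact κ.IsRegular] (i : ι)
    [IsCardinalPresentable (A i) κ] (Z : D) (J : Type v) [SmallCategory J]
    [IsCardinalFiltered J κ] : PreservesColimitsOfShape J (cells A i Z) := by
  have := preservesColimitsOfShape_of_isCardinalPresentable (A i) κ J
  have := (sigmaConstAdj Z).leftAdjoint_preservesColimits
  exact inferInstanceAs (PreservesColimitsOfShape J (_ ⋙ _))

lemma isCardinalAccessible_step (κ : Cardinal.{v}) [Fact κ.IsRegular]
    [∀ i, IsCardinalPresentable (A i) κ] : (step m).IsCardinalAccessible κ where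
  preservesColimitOfShape J _ _ := by
    have h₁ : ∀ Z : ι → D, PreservesColimitsOfShape J (∐ fun i ↦ cells A i (Z i)) := fun Z ↦
      preservesColimitsOfShape_of_isColimit (colimit.isColimit _)
        (fun ⟨i⟩ ↦ preservesColimitsOfShape_cells κ i (Z i) J)
    refine preservesColimitsOfShape_of_isColimit (colimit.isColimit
      (span (Limits.Sigma.map (cellsMap m)) (Limits.Sigma.desc (attach A)))) ?_
    rintro (_ | _ | _)
    · exact h₁ _
    · exact h₁ _
    · exact inferInstanceAs (PreservesColimitsOfShape J (𝟭 D))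

section Iteration

open SmallObject

variable (κ : Cardinal.{v}) [OrderBot κ.ord.ToType]

/-- The successor structure which corresponds to attaching all possible cells. -/
noncomputable def succStruct : SuccStruct (D ⥤ D) := SuccStruct.ofNatTrans (toStep m)

lemma llp_rlp_ιIteration :
    ((MorphismProperty.ofHoms m).rlp.llp.functorCategory D)
      ((succStruct m).ιIteration κ.ord.ToType) :=
  MorphismProperty.transfiniteCompositionsOfShape_le _ κ.ord.ToType _
    ⟨((succStruct m).transfiniteCompositionOfShapeιIteration κ.ord.ToType).ofLE (by
      rintro F _ _ ⟨_⟩ X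
      exact llp_rlp_toStep m (F.obj X))⟩

variable [Fact κ.IsRegular]

lemma preservesColimitsOfShape_iterationFunctor_obj [∀ i, IsCardinalPresentable (A i) κ]
    (J : Type v) [SmallCategory J] [IsCardinalFiltered J κ] (j : κ.ord.ToType) :
    PreservesColimitsOfShape J (((succStruct m).iterationFunctor κ.ord.ToType).obj j) := by
  induction j using SuccOrder.limitRecOn with
  | isMin j hj =>
    obtain rfl := hj.eq_bot
    have : PreservesColimitsOfShape J (succStruct m).X₀ :=
      inferInstanceAs (PreservesColimitsOfShape J (𝟭 D))
    exact preservesColimitsOfShape_of_natIso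
      ((succStruct m).iterationFunctorObjBotIso κ.ord.ToType).symm
  | succ j hj hj' =>
    have := isCardinalAccessible_step m κ
    have := (step m).preservesColimitsOfShape_of_isCardinalAccessible κ J
    have : PreservesColimitsOfShape J ((succStruct m).succ
        (((succStruct m).iterationFunctor κ.ord.ToType).obj j)) :=
      inferInstanceAs (PreservesColimitsOfShape J
        (((succStruct m).iterationFunctor κ.ord.ToType).obj j ⋙ step m))
    exact preservesColimitsOfShape_of_natIso
      ((succStruct m).iterationFunctorObjSuccIso j hj).symm
  | isSuccLimit j hj hj' =>
    exact preservesColimitsOfShape_of_isColimit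
      (((succStruct m).iterationFunctor κ.ord.ToType).isColimitOfIsWellOrderContinuous j hj)
      (fun k ↦ hj' k.1 k.2)

lemma isCardinalAccessible_iteration [∀ i, IsCardinalPresentable (A i) κ] :
    ((succStruct m).iteration κ.ord.ToType).IsCardinalAccessible κ where
  preservesColimitOfShape J _ _ :=
    preservesColimitsOfShape_of_isColimit
      ((succStruct m).isColimitIterationCocone κ.ord.ToType)
      (preservesColimitsOfShape_iterationFunctor_obj m κ J)

/-- By presentability, a map from A i to the colimit factors through some stage j, and it extends
along m i at the successor stage. -/
lemma isInjective_iteration_obj [∀ i, IsCardinalPresentable (A i) κ] (X : D) :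
    IsInjective m (((succStruct m).iteration κ.ord.ToType).obj X) := by
  intro i x
  have hc := isColimitOfPreserves ((evaluation D D).obj X)
    ((succStruct m).isColimitIterationCocone κ.ord.ToType)
  obtain ⟨j, x, rfl⟩ := IsCardinalPresentable.exists_hom_of_isColimit κ hc x
  obtain ⟨y, hy⟩ := exists_extension_toStep m i x
  have := Cardinal.noMaxOrder (Fact.elim inferInstance : κ.IsRegular).aleph0_le
  let S := succStruct m
  let c := S.iterationCocone κ.ord.ToType
  have h : Functor.whiskerLeft ((S.iterationFunctor κ.ord.ToType).obj j) (toStep m) ≫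
      (S.iterationFunctorObjSuccIso j (not_isMax j)).inv ≫ c.ι.app (Order.succ j) =
        c.ι.app j := by
    have := S.iterationFunctor_map_succ j (not_isMax j)
    rw [← c.w (homOfLE (Order.le_succ j)), this, Category.assoc]
    rfl
  refine ⟨y ≫ (S.iterationFunctorObjSuccIso j (not_isMax j)).inv.app X ≫
    (c.ι.app (Order.succ j)).app X, ?_⟩
  have h' := x ≫= NatTrans.congr_app h X
  refine Eq.trans ?_ h'
  rw [← Category.assoc, hy, Category.assoc]
  rfl

end Iteration

/-- The weak reflection in the injective objects with respect to a family of morphisms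
between `κ`-presentable objects may be chosen to be functorial and `κ`-accessible. -/
theorem exists_weakReflection (κ : Cardinal.{v}) [Fact κ.IsRegular]
    [∀ i, IsCardinalPresentable (A i) κ] :
    ∃ (Φ : D ⥤ D) (η : 𝟭 D ⟶ Φ), Φ.IsCardinalAccessible κ ∧
      (∀ X, (MorphismProperty.ofHoms m).rlp.llp (η.app X)) ∧
      ∀ X, IsInjective m (Φ.obj X) := by
  have : Nonempty κ.ord.ToType := by simpa using Cardinal.IsRegular.ne_zero Fact.out
  have := WellFoundedLT.toOrderBot κ.ord.ToType
  exact ⟨_, (succStruct m).ιIteration κ.ord.ToType, isCardinalAccessible_iteration m κ,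
    llp_rlp_ιIteration m κ, isInjective_iteration_obj m κ⟩

end WeakReflection

end DirectedCylinder

-- Solution sets for preimages of injectivity classes.

universe u'

namespace DirectedCylinder

namespace WeakReflection

/-- Codes for the elements which are obtained from a given element of a `κ`-directed poset by
taking upper bounds of small families and by applying certain unary operations. -/
inductive Code (κ : Cardinal.{v}) (P : Type v) : Type v
  | base : Code κ P
  | sup (S : Set κ.ord.ToType) (f : S → Code κ P) : Code κ P
  | op (p : P) (c : Code κ P) : Code κ P

/-- In a `κ`-directed poset, any element belongs to a `κ`-directed subset which is stable
under given unary operations and whose cardinality is bounded. -/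
lemma exists_closed_range (κ : Cardinal.{v}) [Fact κ.IsRegular] (P : Type v) {J : Type v}
    [PartialOrder J] [IsCardinalFiltered J κ] (j₀ : J) (op : P → J → J) :
    ∃ e : Code κ P → J, j₀ ∈ Set.range e ∧ (∀ p, ∀ j ∈ Set.range e, op p j ∈ Set.range e) ∧
      IsCardinalFiltered (Set.range e) κ := by
  classical
  let ub (S : Set κ.ord.ToType) (f : S → J) : J :=
    if h : ∃ j, ∀ s, f s ≤ j then h.choose else j₀
  have hub (S : Set κ.ord.ToType) (f : S → J) (h : ∃ j, ∀ s, f s ≤ j) (s : S) : f s ≤ ub S f := by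
    dsimp only [ub]
    rw [dif_pos h]
    exact h.choose_spec s
  -- Codes depend on κ and P only, so the size of the range is bounded uniformly in J.
  let e : Code κ P → J := fun c ↦ Code.rec j₀ (fun S _ f ↦ ub S f) (fun p _ j ↦ op p j) c
  refine ⟨e, ⟨.base, rfl⟩, ?_, ?_⟩
  · rintro p _ ⟨c, rfl⟩
    exact ⟨.op p c, rfl⟩
  · refine isCardinalFiltered_preorder _ _ (fun K s hK ↦ ?_)
    choose c hc using fun k ↦ (s k).2
    obtain ⟨φ⟩ : Nonempty (K ↪ κ.ord.ToType) := by
      rw [← Cardinal.le_def]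
      simpa using hK.le
    let ψ := Equiv.ofInjective φ φ.injective
    let c' : Code κ P := .sup (Set.range φ) (fun t ↦ c (ψ.symm t))
    refine ⟨⟨e c', c', rfl⟩, fun k ↦ ?_⟩
    have hK' : HasCardinalLT K κ := by rwa [hasCardinalLT_iff_cardinal_mk_lt]
    have := hub (Set.range φ) (fun t ↦ e (c (ψ.symm t)))
      ⟨IsCardinalFiltered.max (fun k ↦ (s k).1) hK', fun t ↦ by
        rw [hc]
        exact leOfHom (IsCardinalFiltered.toMax (fun k ↦ (s k).1) hK' _)⟩ (ψ k)
    change (s k).1 ≤ ub (Set.range φ) (fun t ↦ e (c (ψ.symm t)))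
    refine le_trans (le_of_eq ?_) this
    rw [Equiv.symm_apply_apply, hc]

variable {D : Type u} [Category.{v} D] {E : Type u'} [Category.{v} E]
  {ι : Type v} {A B : ι → E} (m : ∀ i, A i ⟶ B i)

/-- If a `κ`-filtered colimit is injective, then a given lifting problem for an object in the
diagram has a solution at a further stage. -/
lemma IsInjective.exists_solution {m} {κ : Cardinal.{v}} [Fact κ.IsRegular]
    [∀ i, IsCardinalPresentable (A i) κ] [∀ i, IsCardinalPresentable (B i) κ]
    {J : Type v} [PartialOrder J] [IsCardinalFiltered J κ] {F : J ⥤ E} {c : Cocone F}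
    (hc : IsColimit c) (h : IsInjective m c.pt) {i : ι} {j : J} (x : A i ⟶ F.obj j) :
    ∃ (j' : J) (hj : j ≤ j') (y : B i ⟶ F.obj j'), m i ≫ y = x ≫ F.map (homOfLE hj) := by
  obtain ⟨y, hy⟩ := h i (x ≫ c.ι.app j)
  obtain ⟨k, y, rfl⟩ := IsCardinalPresentable.exists_hom_of_isColimit κ hc y
  obtain ⟨l, f, g, hfg⟩ := IsCardinalPresentable.exists_eq_of_isColimit κ hc (m i ≫ y) x
    (by simpa using hy)
  exact ⟨l, leOfHom g, y ≫ F.map f, by rwa [← Category.assoc]⟩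

/-- Given a regular cardinal `κ` and a small type `X`, there is a larger regular cardinal
which bounds the cardinality of `X`. -/
lemma exists_isRegular_le_hasCardinalLT (κ : Cardinal.{v}) (X : Type v) :
    ∃ (κ' : Cardinal.{v}) (_ : Fact κ'.IsRegular), κ ≤ κ' ∧ HasCardinalLT X κ' := by
  obtain ⟨κ', h₁, h₂⟩ := HasCardinalLT.exists_regular_cardinal_forall.{v}
    (Sum.elim (fun (_ : Unit) ↦ X) (fun (_ : Unit) ↦ κ.ord.ToType))
  exact ⟨κ', ⟨h₁⟩, le_of_lt (by simpa [hasCardinalLT_iff_cardinal_mk_lt] using h₂ (Sum.inr ⟨⟩)),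
    h₂ (Sum.inl ⟨⟩)⟩

lemma hasCardinalLT_arrow_range {X J : Type v} [PartialOrder J] (e : X → J) {κ : Cardinal.{v}}
    (h : HasCardinalLT (X × X) κ) : HasCardinalLT (Arrow (Set.range e)) κ := by
  have h' : HasCardinalLT (Set.range e × Set.range e) κ :=
    h.of_surjective (Prod.map (Set.rangeFactorization e) (Set.rangeFactorization e))
      (Set.rangeFactorization_surjective.prodMap Set.rangeFactorization_surjective)
  refine h'.of_injective (fun f ↦ (f.left, f.right)) ?_
  rintro ⟨a, b, f⟩ ⟨a', b', f'⟩ h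
  obtain ⟨rfl, rfl⟩ := Prod.ext_iff.1 h
  obtain rfl := Subsingleton.elim f f'
  rfl

/-- The solution set condition for the class of objects which are sent by a `κ`-accessible
functor to injective objects with respect to a family of morphisms
between `κ`-presentable objects. -/
theorem exists_solutionSet (κ : Cardinal.{v}) [Fact κ.IsRegular]
    [IsCardinalLocallyPresentable D κ] (Φ : D ⥤ E) [Φ.IsCardinalAccessible κ]
    [∀ i, IsCardinalPresentable (A i) κ] [∀ i, IsCardinalPresentable (B i) κ] :
    ∃ (Q : ObjectProperty D) (_ : ObjectProperty.Small.{v} Q),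
      (∀ Y, Q Y → IsInjective m (Φ.obj Y)) ∧
      ∀ ⦃K X : D⦄ [IsCardinalPresentable K κ] (_ : IsInjective m (Φ.obj X)) (f : K ⟶ X),
        ∃ (Y : D) (_ : Q Y) (g : K ⟶ Y) (h : Y ⟶ X), g ≫ h = f := by
  obtain ⟨G, _, hG⟩ := HasCardinalFilteredGenerator.exists_small_generator D κ
  -- P lists all lifting problems posed at generators. Neither P nor the cardinal κ' chosen below
  -- depends on X.
  let P : Type v := Σ (i : ι) (p : Shrink.{v} (Subtype G)),
    A i ⟶ Φ.obj ((equivShrink (Subtype G)).symm p).1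
  obtain ⟨κ', _, hκ, hκ'⟩ := exists_isRegular_le_hasCardinalLT κ (Code κ P × Code κ P)
  have : IsCardinalLocallyPresentable D κ' := .of_le D hκ
  obtain ⟨Q, _, hQ, hQ'⟩ :=
    ObjectProperty.EssentiallySmall.exists_small_le.{v} (isCardinalPresentable D κ')
  refine ⟨Q ⊓ fun Y ↦ IsInjective m (Φ.obj Y), inferInstance, fun Y hY ↦ hY.2, ?_⟩
  intro K X _ hX f
  obtain ⟨J₀, _, _, ⟨pres₀⟩⟩ := hG.exists_colimitsOfShape X
  obtain ⟨J, _, _, G₀, _⟩ := IsCardinalFiltered.exists_cardinal_directed J₀ κ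
  obtain ⟨pres⟩ := G.colimitsOfShape_le_of_final G₀ _ ⟨pres₀⟩
  have := Φ.preservesColimitsOfShape_of_isCardinalAccessible κ J
  -- The stage j' solves problem p if p is posed at j. Heterogeneous equality is needed because the
  -- object at stage j is only propositionally equal to the listed generator.
  have sol (p : P) (j : J) : ∃ j' : J, ∀ x : A p.1 ⟶ Φ.obj (pres.diag.obj j), x ≍ p.2.2 →
      ∃ (hj : j ≤ j') (y : B p.1 ⟶ Φ.obj (pres.diag.obj j')),
        m p.1 ≫ y = x ≫ Φ.map (pres.diag.map (homOfLE hj)) := by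
    by_cases hx : ∃ x : A p.1 ⟶ Φ.obj (pres.diag.obj j), x ≍ p.2.2
    · obtain ⟨x, hx⟩ := hx
      obtain ⟨j', hj, y, hy⟩ := IsInjective.exists_solution (κ := κ)
        (isColimitOfPreserves Φ pres.isColimit) hX x
      refine ⟨j', fun x' hx' ↦ ⟨hj, y, ?_⟩⟩
      obtain rfl := eq_of_heq (hx'.trans hx.symm)
      exact hy
    · exact ⟨j, fun x hx' ↦ (hx ⟨x, hx'⟩).elim⟩
  choose op hop using sol
  obtain ⟨j₀, f, rfl⟩ := IsCardinalPresentable.exists_hom_of_isColimit κ pres.isColimit f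
  -- The subdiagram is small enough for its colimit to be κ'-presentable, and closed enough for Φ of
  -- its colimit to be injective.
  obtain ⟨e, he₀, he, _⟩ := exists_closed_range κ P j₀ op
  have hmono : Monotone (fun j : Set.range e ↦ j.1) := fun _ _ h ↦ h
  let F : Set.range e ⥤ D := hmono.functor ⋙ pres.diag
  have hY : IsCardinalPresentable (colimit F) κ' := by
    have (j : Set.range e) : IsCardinalPresentable (F.obj j) κ' :=
      have : IsCardinalPresentable (F.obj j) κ :=
        hG.le_isCardinalPresentable _ (pres.prop_diag_obj j.1)
      isCardinalPresentable_of_le _ hκ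
    exact isCardinalPresentable_of_isColimit _ (colimit.isColimit F) κ'
      (hasCardinalLT_arrow_range e hκ')
  have hY' : IsInjective m (Φ.obj (colimit F)) := by
    intro i x
    have := Φ.preservesColimitsOfShape_of_isCardinalAccessible κ (Set.range e)
    have hc := isColimitOfPreserves Φ (colimit.isColimit F)
    obtain ⟨⟨j, hj⟩, x, rfl⟩ := IsCardinalPresentable.exists_hom_of_isColimit κ hc x
    obtain ⟨p, hp⟩ : ∃ p : Shrink.{v} (Subtype G),
        pres.diag.obj j = ((equivShrink (Subtype G)).symm p).1 :=
      ⟨equivShrink _ ⟨_, pres.prop_diag_obj j⟩, by simp⟩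
    let x' : A i ⟶ Φ.obj (pres.diag.obj j) := x
    obtain ⟨hj', y, hy⟩ := hop ⟨i, p, x' ≫ eqToHom (by rw [hp])⟩ j x'
      (comp_eqToHom_heq x' _).symm
    let j' : Set.range e := ⟨_, he ⟨i, p, x' ≫ eqToHom (by rw [hp])⟩ j hj⟩
    let φ : (⟨j, hj⟩ : Set.range e) ⟶ j' := homOfLE hj'
    refine ⟨y ≫ Φ.map (colimit.ι F j'), ?_⟩
    rw [← Category.assoc, hy, Category.assoc]
    refine x' ≫= ?_
    exact (Φ.map_comp _ _).symm.trans (congr_arg Φ.map (colimit.w F φ))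
  obtain ⟨Z, hZ, ⟨iso⟩⟩ := hQ' _ hY
  obtain ⟨g, hg⟩ : ∃ g : pres.diag.obj j₀ ⟶ colimit F,
      g ≫ colimit.desc F (pres.cocone.whisker _) = pres.ι.app j₀ :=
    ⟨colimit.ι F ⟨j₀, he₀⟩, colimit.ι_desc _ _⟩
  exact ⟨Z, ⟨hZ, hY'.of_iso (Φ.mapIso iso)⟩, f ≫ g ≫ iso.hom,
    iso.inv ≫ colimit.desc F (pres.cocone.whisker _), by simp [hg]⟩

end WeakReflection

end DirectedCylinder

/-! ### Presentability of arrow categories and the small object argument. -/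

namespace DirectedCylinder

section LocallyPresentable

/-- The functor which sends an arrow to the corresponding functor from `Fin 2`. -/
def arrowToComposableArrows (C : Type u) [Category.{v} C] : Arrow C ⥤ ComposableArrows C 1 where
  obj f := .mk₁ f.hom
  map φ := ComposableArrows.homMk₁ φ.left φ.right φ.w.symm

instance (C : Type u) [Category.{v} C] : (arrowToComposableArrows C).IsEquivalence where
  faithful := ⟨fun h ↦ Arrow.hom_ext _ _ (NatTrans.congr_app h 0) (NatTrans.congr_app h 1)⟩
  full := ⟨fun φ ↦ ⟨Arrow.homMk (φ.app 0) (φ.app 1)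
    (ComposableArrows.naturality' φ 0 1).symm, ComposableArrows.hom_ext₁ rfl rfl⟩⟩
  essSurj := ⟨fun F ↦ by
    obtain ⟨X, Y, f, rfl⟩ := ComposableArrows.mk₁_surjective F
    exact ⟨Arrow.mk f, ⟨Iso.refl _⟩⟩⟩

/-- Any small family of presentable objects consists of `κ`-presentable objects for a
sufficiently large regular cardinal `κ`. -/
lemma exists_isRegular_forall_isCardinalPresentable {C : Type u} [Category.{v} C]
    {ι : Type v} (X : ι → C)
    [∀ i, IsPresentable.{v} (X i)] (κ₀ : Cardinal.{v}) :
    ∃ (κ : Cardinal.{v}) (_ : Fact κ.IsRegular), κ₀ ≤ κ ∧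
      ∀ i, IsCardinalPresentable (X i) κ := by
  choose κ h h' using fun i ↦ Functor.IsAccessible.exists_cardinal.{v}
    (F := coyoneda.obj (Opposite.op (X i)))
  obtain ⟨κ', _, h₀, h₁⟩ := WeakReflection.exists_isRegular_le_hasCardinalLT κ₀
    (Σ i, (κ i).ord.ToType)
  refine ⟨κ', inferInstance, h₀, fun i ↦ ?_⟩
  have hκ : HasCardinalLT (κ i).ord.ToType κ' :=
    h₁.of_injective (fun x ↦ (⟨i, x⟩ : Σ i, (κ i).ord.ToType)) fun _ _ h ↦ by simpa using h
  have := h' i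
  exact isCardinalPresentable_of_le (κ := κ i) _ (le_of_lt (by
    simpa [hasCardinalLT_iff_cardinal_mk_lt] using hκ))

variable {C : Type u} [Category.{v} C] [IsLocallyPresentable.{v} C]

instance : HasColimitsOfSize.{v, v} C := hasColimits_of_isLocallyPresentable

instance : HasLimitsOfSize.{v, v} C := hasLimits_of_isLocallyPresentable

instance : IsLocallyPresentable.{v} (Arrow C) := by
  let T := ULift.{v} (Fin 2)
  let e : Tᵒᵖ ≌ Fin 2 := (orderDualEquivalence T).symm.trans
    (OrderIso.equivalence (ULift.orderIso.{v}.dual.trans Fin.revOrderIso))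
  exact (e.congrLeft.trans (arrowToComposableArrows C).asEquivalence.symm).isLocallyPresentable

lemma exists_isRegular_isCardinalLocallyPresentable {ι : Type v} (X : ι → C) :
    ∃ (κ : Cardinal.{v}) (_ : Fact κ.IsRegular), IsCardinalLocallyPresentable C κ ∧
      ∀ i, IsCardinalPresentable (X i) κ := by
  obtain ⟨κ₀, _, _⟩ := IsLocallyPresentable.exists_cardinal.{v} C
  obtain ⟨κ, _, h, h'⟩ := exists_isRegular_forall_isCardinalPresentable X κ₀
  exact ⟨κ, inferInstance, .of_le C h, h'⟩

/-- In a locally presentable category, any small class of morphisms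
permits the small object argument. -/
lemma hasSmallObjectArgument (S : MorphismProperty C) [MorphismProperty.IsSmall.{v} S] :
    MorphismProperty.HasSmallObjectArgument.{v} S := by
  obtain ⟨κ, _, _, h⟩ := exists_isRegular_isCardinalLocallyPresentable
    (fun i : Shrink.{v} S.toSet ↦ ((equivShrink _).symm i).1.left)
  have : Nonempty κ.ord.ToType := by simpa using Cardinal.IsRegular.ne_zero Fact.out
  refine ⟨κ, inferInstance, WellFoundedLT.toOrderBot κ.ord.ToType, ?_⟩
  let _ := WellFoundedLT.toOrderBot κ.ord.ToType
  exact {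
    preservesColimit {A B X Y} i hi f hf := by
      have : IsCardinalPresentable A κ := by
        simpa using h (equivShrink _ ⟨Arrow.mk i, hi⟩)
      have := preservesColimitsOfShape_of_isCardinalPresentable A κ κ.ord.ToType
      infer_instance }

end LocallyPresentable

end DirectedCylinder

/-! ### Fibrant replacement of arrows and the solution set for right equivalences. -/

namespace DirectedCylinder

open WeakReflection

section Arrow

variable {C : Type u} [Category.{v} C] {ι : Type v} {A B : ι → C} (l : ∀ i, A i ⟶ B i)

/-- For a morphism `l : A ⟶ B`, this is the morphism `l ⟶ 𝟙 B` in the category of arrows. -/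
def arrowToId {A B : C} (l : A ⟶ B) : Arrow.mk l ⟶ Arrow.mk (𝟙 B) := Arrow.homMk l (𝟙 B)

lemma isInjective_arrowToId_iff (f : Arrow C) :
    IsInjective (fun i ↦ arrowToId (l i)) f ↔ (MorphismProperty.ofHoms l).rlp f.hom := by
  constructor
  · rintro hf _ _ _ ⟨i⟩
    refine ⟨fun {t b} sq ↦ ?_⟩
    obtain ⟨y, hy⟩ := hf i (Arrow.homMk t b sq.w)
    have h₁ : l i ≫ y.left = t := congr_arg CommaMorphism.left hy
    have h₂ : 𝟙 _ ≫ y.right = b := congr_arg CommaMorphism.right hy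
    have h₃ : y.left ≫ f.hom = 𝟙 _ ≫ y.right := y.w
    exact ⟨⟨{ l := y.left, fac_left := h₁, fac_right := h₃.trans h₂ }⟩⟩
  · intro hf i x
    have sq : CommSq x.left (l i) f.hom x.right := ⟨x.w⟩
    have := hf _ ⟨i⟩
    exact ⟨Arrow.homMk sq.lift x.right (by simp), Arrow.hom_ext _ _ sq.fac_left
      (Category.id_comp _)⟩

variable [HasInitial C]

/-- Given a family of morphisms `l` in a category, this is a family of morphisms in the category
of arrows which detects the arrows with the right lifting property against `l` and whose
target is injective with respect to `l`. -/
noncomputable def arrowFamily : ∀ (x : ι ⊕ ι),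
    Sum.elim (fun i ↦ Arrow.mk (l i)) (fun i ↦ Arrow.mk (initial.to (A i))) x ⟶
      Sum.elim (fun i ↦ Arrow.mk (𝟙 (B i))) (fun i ↦ Arrow.mk (initial.to (B i))) x
  | .inl i => arrowToId (l i)
  | .inr i => Arrow.homMk (𝟙 (⊥_ C)) (l i) (initialIsInitial.hom_ext _ _)

lemma IsInjective.rlp_hom_of_arrowFamily {f : Arrow C} (hf : IsInjective (arrowFamily l) f) :
    (MorphismProperty.ofHoms l).rlp f.hom :=
  (isInjective_arrowToId_iff l f).1 fun i ↦ hf (.inl i)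

lemma IsInjective.right_of_arrowFamily {f : Arrow C} (hf : IsInjective (arrowFamily l) f) :
    IsInjective l f.right := fun i x ↦ by
  obtain ⟨y, hy⟩ := hf (.inr i) (Arrow.homMk (initial.to _) x (initialIsInitial.hom_ext _ _))
  exact ⟨y.right, congr_arg CommaMorphism.right hy⟩

variable {l}

/-- The target functor has right adjoint E ↦ 𝟙 E, and it sends the family to identities and members
of l. Hence the right adjoint preserves the right classes and the target functor the left classes.
-/
lemma llp_rlp_right_of_arrowFamily {f g : Arrow C} {φ : f ⟶ g}
    (hφ : (MorphismProperty.ofHoms (arrowFamily l)).rlp.llp φ) :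
    (MorphismProperty.ofHoms l).rlp.llp φ.right := by
  intro E F p hp
  let P : Arrow.mk (𝟙 E) ⟶ Arrow.mk (𝟙 F) := Arrow.homMk p p (by simp)
  have hP : (MorphismProperty.ofHoms (arrowFamily l)).rlp P := by
    rintro _ _ _ ⟨i | i⟩
    · refine ⟨fun {t : Arrow.mk (l i) ⟶ Arrow.mk (𝟙 E)} {b : Arrow.mk (𝟙 (B i)) ⟶ Arrow.mk (𝟙 F)}
        sq ↦ ?_⟩
      have ht : t.left ≫ 𝟙 E = l i ≫ t.right := t.w
      have hb : b.left ≫ 𝟙 F = 𝟙 _ ≫ b.right := b.w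
      have hid : t.right ≫ 𝟙 E = 𝟙 (B i) ≫ t.right := by simp
      have hr : t.right ≫ p = 𝟙 _ ≫ b.right := congr_arg CommaMorphism.right sq.w
      refine ⟨⟨{ l := Arrow.homMk t.right t.right hid, fac_left := ?_, fac_right := ?_ }⟩⟩
      · exact Arrow.hom_ext _ _ (ht.symm.trans (Category.comp_id _)) (Category.id_comp _)
      · exact Arrow.hom_ext _ _ (hr.trans (hb.symm.trans (Category.comp_id _)))
          (hr.trans (Category.id_comp _))
    · refine ⟨fun {t : Arrow.mk (initial.to (A i)) ⟶ Arrow.mk (𝟙 E)}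
        {b : Arrow.mk (initial.to (B i)) ⟶ Arrow.mk (𝟙 F)} sq ↦ ?_⟩
      have := hp _ ⟨i⟩
      have sq' : CommSq t.right (l i) p b.right := ⟨congr_arg CommaMorphism.right sq.w⟩
      refine ⟨⟨{
        l := Arrow.homMk (initial.to E) sq'.lift (initialIsInitial.hom_ext _ _)
        fac_left := ?_, fac_right := ?_ }⟩⟩
      · exact Arrow.hom_ext _ _ (initialIsInitial.hom_ext _ _) sq'.fac_left
      · exact Arrow.hom_ext _ _ (initialIsInitial.hom_ext _ _) sq'.fac_right
  refine ⟨fun {t b} sq ↦ ?_⟩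
  have := hφ _ hP
  have hw : f.hom ≫ φ.right = φ.left ≫ g.hom := φ.w.symm
  have sq' : CommSq (Arrow.homMk (f.hom ≫ t) t (Category.comp_id _) : f ⟶ Arrow.mk (𝟙 E)) φ P
      (Arrow.homMk (g.hom ≫ b) b (Category.comp_id _) : g ⟶ Arrow.mk (𝟙 F)) := ⟨by
    refine Arrow.hom_ext _ _ ?_ sq.w
    change (f.hom ≫ t) ≫ p = φ.left ≫ g.hom ≫ b
    rw [Category.assoc, sq.w, reassoc_of% hw]⟩
  exact ⟨⟨{
    l := sq'.lift.right
    fac_left := congr_arg CommaMorphism.right sq'.fac_left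
    fac_right := congr_arg CommaMorphism.right sq'.fac_right }⟩⟩

/-- The same adjunction argument for the source functor, whose right adjoint is E ↦ (E ⟶ *). -/
lemma llp_rlp_left_of_arrowFamily [HasTerminal C] {f g : Arrow C} {φ : f ⟶ g}
    (hφ : (MorphismProperty.ofHoms (arrowFamily l)).rlp.llp φ) :
    (MorphismProperty.ofHoms l).rlp.llp φ.left := by
  intro E F p hp
  let P : Arrow.mk (terminal.from E) ⟶ Arrow.mk (terminal.from F) :=
    Arrow.homMk p (𝟙 _) (terminalIsTerminal.hom_ext _ _)
  have hP : (MorphismProperty.ofHoms (arrowFamily l)).rlp P := by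
    rintro _ _ _ ⟨i | i⟩
    · refine ⟨fun {t : Arrow.mk (l i) ⟶ Arrow.mk (terminal.from E)} {b : Arrow.mk (𝟙 (B i)) ⟶ Arrow.mk (terminal.from F)}
        sq ↦ ?_⟩
      have := hp _ ⟨i⟩
      have sq' : CommSq t.left (l i) p b.left := ⟨congr_arg CommaMorphism.left sq.w⟩
      refine ⟨⟨{
        l := Arrow.homMk sq'.lift (terminal.from _) (terminalIsTerminal.hom_ext _ _)
        fac_left := ?_, fac_right := ?_ }⟩⟩
      · exact Arrow.hom_ext _ _ sq'.fac_left (terminalIsTerminal.hom_ext _ _)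
      · exact Arrow.hom_ext _ _ sq'.fac_right (terminalIsTerminal.hom_ext _ _)
    · refine ⟨fun {t : Arrow.mk (initial.to (A i)) ⟶ Arrow.mk (terminal.from E)}
        {b : Arrow.mk (initial.to (B i)) ⟶ Arrow.mk (terminal.from F)} sq ↦ ?_⟩
      refine ⟨⟨{
        l := Arrow.homMk (initial.to E) (terminal.from _) (terminalIsTerminal.hom_ext _ _)
        fac_left := ?_, fac_right := ?_ }⟩⟩
      · exact Arrow.hom_ext _ _ (initialIsInitial.hom_ext _ _) (terminalIsTerminal.hom_ext _ _)
      · exact Arrow.hom_ext _ _ (initialIsInitial.hom_ext _ _) (terminalIsTerminal.hom_ext _ _)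
  refine ⟨fun {t b} sq ↦ ?_⟩
  have := hφ _ hP
  have sq' : CommSq (Arrow.homMk t (terminal.from _) (terminalIsTerminal.hom_ext _ _) :
      f ⟶ Arrow.mk (terminal.from E)) φ P
      (Arrow.homMk b (terminal.from _) (terminalIsTerminal.hom_ext _ _) :
        g ⟶ Arrow.mk (terminal.from F)) :=
    ⟨Arrow.hom_ext _ _ sq.w (terminalIsTerminal.hom_ext _ _)⟩
  exact ⟨⟨{
    l := sq'.lift.left
    fac_left := congr_arg CommaMorphism.left sq'.fac_left
    fac_right := congr_arg CommaMorphism.left sq'.fac_right }⟩⟩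

end Arrow

section SolutionSet

variable {C : Type u} [Category.{v} C]

/-- The solution set condition for a class of morphisms `W` with respect to `S`: any morphism
from an arrow in `S` to an arrow in `W` factors through an arrow which belongs to a small subset
of `W`. -/
def SolutionSetCondition (S W : MorphismProperty C) : Prop :=
  ∃ Q : MorphismProperty C, MorphismProperty.IsSmall.{v} Q ∧ Q ≤ W ∧
    ∀ (s w : Arrow C), S s.hom → W w.hom → ∀ (φ : s ⟶ w),
      ∃ (q : Arrow C) (_ : Q q.hom) (a : s ⟶ q) (b : q ⟶ w), a ≫ b = φ

namespace FunctorialCylinder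

variable [IsLocallyPresentable.{v} C] {L : MorphismProperty C} {cyl : FunctorialCylinder L}
  {An : MorphismProperty C}

/-- The solution set condition for right equivalences. -/
theorem IsRightAnodyneClass.solutionSetCondition (hAn : cyl.IsRightAnodyneClass An)
    (hcof : ∀ X : C, L (initial.to X)) (hcyl : cyl.IsExact)
    {S : MorphismProperty C} [MorphismProperty.IsSmall.{v} S] (hS : S.rlp = L.rlp) :
    SolutionSetCondition S (rightEquivalences cyl An) := by
  obtain ⟨ι, A, B, s, rfl⟩ := (MorphismProperty.isSmall_iff_eq_ofHoms.{v} S).1 inferInstance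
  obtain ⟨Λ, _, _, hΛ⟩ := hAn.exists_generators
  obtain ⟨ι', A', B', l, rfl⟩ := (MorphismProperty.isSmall_iff_eq_ofHoms.{v} Λ).1 inferInstance
  have hl : (MorphismProperty.ofHoms l).rlp = An.rlp := by simp [hΛ]
  obtain ⟨κ, _, _, hκ⟩ := exists_isRegular_isCardinalLocallyPresentable
    (Sum.elim (Sum.elim (fun i ↦ Arrow.mk (l i)) (fun i ↦ Arrow.mk (initial.to (A' i))))
      (Sum.elim (fun i ↦ Arrow.mk (s i)) (fun i ↦ Arrow.mk (𝟙 (B i)))))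
  have h₁ (i : ι' ⊕ ι') : IsCardinalPresentable (Sum.elim (fun i ↦ Arrow.mk (l i))
    (fun i ↦ Arrow.mk (initial.to (A' i))) i) κ := hκ (.inl i)
  have h₂ (i : ι) : IsCardinalPresentable (Arrow.mk (s i)) κ := hκ (.inr (.inl i))
  have h₃ (i : ι) : IsCardinalPresentable (Arrow.mk (𝟙 (B i))) κ := hκ (.inr (.inr i))
  obtain ⟨Φ, η, _, hη, hΦ⟩ := exists_weakReflection (arrowFamily l) κ
  -- Two-out-of-three along the anodyne components of η reduces f to Φ f, a right fibration between
  -- right fibrant objects, where right equivalence means lifting against S.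
  have hW (f : Arrow C) : rightEquivalences cyl An f.hom ↔
      IsInjective (fun i ↦ arrowToId (s i)) (Φ.obj f) := by
    have hleft : rightEquivalences cyl An (η.app f).left :=
      hAn.le_rightEquivalences hcyl _ (by
        rw [hΛ]; exact llp_rlp_left_of_arrowFamily (hη f))
    have hright : rightEquivalences cyl An (η.app f).right :=
      hAn.le_rightEquivalences hcyl _ (by
        rw [hΛ]; exact llp_rlp_right_of_arrowFamily (hη f))
    have hp : An.rlp (Φ.obj f).hom := by
      rw [← hl]; exact IsInjective.rlp_hom_of_arrowFamily l (hΦ f)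
    have hY : IsRightFibrant An (Φ.obj f).right := by
      rw [IsRightFibrant, rightFibrations, ← hl]
      rintro _ _ _ ⟨i⟩
      refine ⟨fun {t b} sq ↦ ?_⟩
      obtain ⟨y, hy⟩ := IsInjective.right_of_arrowFamily l (hΦ f) i t
      exact ⟨⟨{ l := y, fac_left := hy, fac_right := terminalIsTerminal.hom_ext _ _ }⟩⟩
    have w : (η.app f).left ≫ (Φ.obj f).hom = f.hom ≫ (η.app f).right := (η.app f).w
    rw [isInjective_arrowToId_iff, hS]
    constructor
    · intro hf
      refine hAn.rlp_of_rightEquivalences hcof hcyl hp (.of_rightFibrations hp hY) hY ?_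
      refine MorphismProperty.of_precomp _ _ _ hleft ?_
      rw [w]
      exact MorphismProperty.comp_mem _ _ _ hf hright
    · intro hf
      refine MorphismProperty.of_postcomp _ _ _ hright ?_
      rw [← w]
      exact MorphismProperty.comp_mem _ _ _ hleft (rlp_le_rightEquivalences hcof _ hf)
  obtain ⟨Q, _, hQ, hQ'⟩ := exists_solutionSet (fun i ↦ arrowToId (s i)) κ Φ
  refine ⟨fun _ _ f ↦ Q (Arrow.mk f), ⟨inferInstanceAs (Small.{v} (Subtype Q))⟩,
    fun _ _ f hf ↦ (hW (Arrow.mk f)).2 (hQ _ hf), ?_⟩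
  intro σ w hσ hw φ
  have : IsCardinalPresentable σ κ := by
    obtain ⟨i, hi⟩ := (MorphismProperty.ofHoms_iff _ _).1 hσ
    obtain rfl : σ = Arrow.mk (s i) := hi
    exact h₂ i
  exact hQ' ((hW w).1 hw) φ

end FunctorialCylinder

end SolutionSet

/-! ### Smith's argument. -/

section Smith

variable {C : Type u} [Category.{v} C] {L W S : MorphismProperty C}

/-- Given a solution set for `W` and a weak factorization system `(L, L.rlp)` whose right
class is contained in `W`, the arrows in the solution set may be chosen in `L`. -/
lemma SolutionSetCondition.exists_le_inf [HasPushouts C] [W.HasTwoOutOfThreeProperty]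
    [MorphismProperty.IsSmall.{v} S] [L.IsWeakFactorizationSystem L.rlp] (hSL : S ≤ L)
    (hLW : L.rlp ≤ W) (h : SolutionSetCondition S W) :
    ∃ J : MorphismProperty C, MorphismProperty.IsSmall.{v} J ∧ J ≤ L ⊓ W ∧
      ∀ (s w : Arrow C), S s.hom → W w.hom → ∀ (φ : s ⟶ w),
        ∃ (j : Arrow C) (_ : J j.hom) (a : s ⟶ j) (b : j ⟶ w), a ≫ b = φ := by
  obtain ⟨Q, _, hQW, hQ⟩ := h
  have hL : L.rlp.llp = L := MorphismProperty.llp_eq_of_wfs _ _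
  have key (s q : Arrow C) (hs : S s.hom) (hq : Q q.hom) (φ : s ⟶ q) :
      ∃ (j : Arrow C), (L ⊓ W) j.hom ∧ ∃ (a : s ⟶ j) (b : j ⟶ q), a ≫ b = φ := by
    -- The new arrow keeps the source of q and replaces its target by the middle object of this
    -- factorization. It is in L by cobase change of s, and in W because composing with the second
    -- factor gives back q.
    let fac := MorphismProperty.factorizationData L L.rlp
      (pushout.desc φ.right q.hom φ.w.symm : pushout s.hom φ.left ⟶ _)
    have h₁ : (pushout.inr s.hom φ.left ≫ fac.i) ≫ fac.p = q.hom := by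
      rw [Category.assoc, fac.fac, pushout.inr_desc]
    have h₂ : (pushout.inl s.hom φ.left ≫ fac.i) ≫ fac.p = φ.right := by
      rw [Category.assoc, fac.fac, pushout.inl_desc]
    refine ⟨Arrow.mk (pushout.inr s.hom φ.left ≫ fac.i), ⟨?_, ?_⟩,
      Arrow.homMk φ.left (pushout.inl s.hom φ.left ≫ fac.i) ?_,
      Arrow.homMk (𝟙 _) fac.p ?_, ?_⟩
    · refine hL.le _ (MorphismProperty.comp_mem _ _ _
        (MorphismProperty.of_isPushout (IsPushout.of_hasPushout s.hom φ.left).flip ?_)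
        (L.le_llp_rlp _ fac.hi))
      exact L.le_llp_rlp _ (hSL _ hs)
    · exact MorphismProperty.of_postcomp W (pushout.inr s.hom φ.left ≫ fac.i) fac.p
        (hLW _ fac.hp) (by rw [h₁]; exact hQW _ hq)
    · exact (pushout.condition_assoc _).symm
    · exact (Category.id_comp _).trans h₁.symm
    · exact Arrow.hom_ext _ _ (Category.comp_id _) h₂
  choose j hj a b hab using key
  let T := Σ (s : Shrink.{v} S.toSet) (q : Shrink.{v} Q.toSet),
    (((equivShrink _).symm s).1 ⟶ ((equivShrink _).symm q).1)
  let F (t : T) : Arrow C := j _ _ ((equivShrink _).symm t.1).2 ((equivShrink _).symm t.2.1).2 t.2.2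
  refine ⟨MorphismProperty.ofHoms (fun t ↦ (F t).hom), inferInstance, ?_, ?_⟩
  · rintro _ _ _ ⟨t⟩
    exact hj _ _ _ _ _
  · intro s w hs hw φ
    obtain ⟨q, hq, x, y, rfl⟩ := hQ s w hs hw φ
    obtain ⟨s', hs'⟩ : ∃ s' : Shrink.{v} S.toSet, ((equivShrink _).symm s').1 = s :=
      ⟨equivShrink _ ⟨s, hs⟩, by simp⟩
    obtain ⟨q', hq'⟩ : ∃ q' : Shrink.{v} Q.toSet, ((equivShrink _).symm q').1 = q :=
      ⟨equivShrink _ ⟨q, hq⟩, by simp⟩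
    subst hs' hq'
    refine ⟨F ⟨s', q', x⟩, ⟨_⟩, a _ _ _ _ x, b _ _ _ _ x ≫ y, ?_⟩
    exact (Category.assoc _ _ _).symm.trans (congr_arg (· ≫ y) (hab _ _ _ _ x))

/-- Smith's argument: a solution set for `W` yields generators for `L ⊓ W`. -/
theorem SolutionSetCondition.hasFactorization [IsLocallyPresentable.{v} C]
    [W.HasTwoOutOfThreeProperty] [MorphismProperty.IsSmall.{v} S]
    [L.IsWeakFactorizationSystem L.rlp] (hS : S.rlp = L.rlp) (hLW : L.rlp ≤ W)
    (h : SolutionSetCondition S W) (hW : (L ⊓ W).rlp.llp = L ⊓ W) :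
    (L ⊓ W).HasFactorization (L ⊓ W).rlp := by
  have hL : L.rlp.llp = L := MorphismProperty.llp_eq_of_wfs _ _
  have hSL : S ≤ L := by rw [← hL, ← hS]; exact S.le_llp_rlp
  obtain ⟨J, _, hJ, hJ'⟩ := h.exists_le_inf hSL hLW
  have := hasSmallObjectArgument J
  have hJW : J.rlp.llp ≤ L ⊓ W := by
    rw [← hW]
    exact MorphismProperty.antitone_llp (MorphismProperty.antitone_rlp hJ)
  -- A square from a generator s to p factors through some member of J, and p lifts against that
  -- member.
  have hJR {X Y : C} (p : X ⟶ Y) (hp : J.rlp p) (hpW : W p) : L.rlp p := by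
    rw [← hS]
    intro A B s hs
    refine ⟨fun {t b} sq ↦ ?_⟩
    obtain ⟨j, hj, x, y, hxy⟩ := hJ' (Arrow.mk s) (Arrow.mk p) hs hpW (Arrow.homMk t b sq.w)
    have := hp _ hj
    have sq' : CommSq y.left j.hom p y.right := ⟨y.w⟩
    have h₁ : x.left ≫ y.left = t := congr_arg CommaMorphism.left hxy
    have h₂ : x.right ≫ y.right = b := congr_arg CommaMorphism.right hxy
    have h₃ : x.left ≫ j.hom = s ≫ x.right := x.w
    exact ⟨⟨{
      l := x.right ≫ sq'.lift
      fac_left := by rw [← reassoc_of% h₃, sq'.fac_left, h₁]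
      fac_right := by rw [Category.assoc, sq'.fac_right, h₂] }⟩⟩
  have hJ_eq : J.rlp.llp = L ⊓ W := by
    refine le_antisymm hJW fun A B i hi ↦ ?_
    let fac := MorphismProperty.factorizationData J.rlp.llp J.rlp i
    have hp : L.rlp fac.p := hJR _ fac.hp
      (MorphismProperty.of_precomp W fac.i fac.p (hJW _ fac.hi).2 (by rw [fac.fac]; exact hi.2))
    have := hp _ hi.1
    exact MorphismProperty.of_retract (RetractArrow.ofLeftLiftingProperty fac.fac) fac.hi
  have : (L ⊓ W).rlp = J.rlp := by rw [← hJ_eq, MorphismProperty.rlp_llp_rlp]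
  rw [this, ← hJ_eq]
  infer_instance

end Smith

end DirectedCylinder

/-! ### Assembling the model structure. -/

namespace DirectedCylinder

section ModelCategory

variable {C : Type u} [Category.{v} C]

lemma FunctorialCylinder.IsRightAnodyneClass.hasFactorization_rlp [IsLocallyPresentable.{v} C]
    {L : MorphismProperty C} {cyl : FunctorialCylinder L} {An : MorphismProperty C}
    (hAn : cyl.IsRightAnodyneClass An) : An.HasFactorization An.rlp := by
  obtain ⟨Λ, _, _, rfl⟩ := hAn.exists_generators
  have := hasSmallObjectArgument Λ
  rw [MorphismProperty.rlp_llp_rlp]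
  infer_instance

/-- The model structure with cofibrations `L` and weak equivalences `W`. -/
@[reducible]
def modelCategoryOfWFS [HasFiniteLimits C] [HasFiniteColimits C] (L W : MorphismProperty C)
    [L.IsWeakFactorizationSystem L.rlp] [W.HasTwoOutOfThreeProperty]
    [(L ⊓ W).HasFactorization (L ⊓ W).rlp] (hRW : L.rlp ≤ W)
    (hLW : (L ⊓ W).rlp.llp = L ⊓ W) : ModelCategory C :=
  letI : CategoryWithCofibrations C := ⟨L⟩
  letI : CategoryWithFibrations C := ⟨(L ⊓ W).rlp⟩
  letI : CategoryWithWeakEquivalences C := ⟨W⟩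
  -- Trivial fibrations are identified by the retract argument, whose first factor lies in L ∩ W by
  -- two-out-of-three.
  have h : (L ⊓ W).rlp ⊓ W = L.rlp := by
    refine le_antisymm ?_ fun _ _ p hp ↦ ⟨fun _ _ _ hi ↦ hp _ hi.1, hRW _ hp⟩
    rintro X Y p ⟨hp, hpW⟩
    let fac := MorphismProperty.factorizationData L L.rlp p
    have := hp _ ⟨fac.hi, MorphismProperty.of_postcomp W fac.i fac.p (hRW _ fac.hp)
      (by rwa [fac.fac])⟩
    exact MorphismProperty.of_retract (RetractArrow.ofRightLiftingProperty fac.fac) fac.hp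
  have : (weakEquivalences C).HasTwoOutOfThreeProperty :=
    inferInstanceAs W.HasTwoOutOfThreeProperty
  have : (cofibrations C).IsWeakFactorizationSystem (trivialFibrations C) := by
    change L.IsWeakFactorizationSystem ((L ⊓ W).rlp ⊓ W)
    rw [h]
    infer_instance
  have : (trivialCofibrations C).IsWeakFactorizationSystem (fibrations C) :=
    { rlp := rfl
      llp := hLW
      hasFactorization := inferInstanceAs ((L ⊓ W).HasFactorization (L ⊓ W).rlp) }
  ModelCategory.mk' C

lemma fibrations_eq_rlp [ModelCategory C] :
    fibrations C = (cofibrations C ⊓ weakEquivalences C).rlp :=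
  (MorphismProperty.rlp_eq_of_wfs (trivialCofibrations C) (fibrations C)).symm

/-- A model structure is determined by its cofibrations and weak equivalences. -/
lemma modelCategory_ext (M₁ M₂ : ModelCategory C)
    (h₁ : @cofibrations C _ M₁.categoryWithCofibrations =
      @cofibrations C _ M₂.categoryWithCofibrations)
    (h₂ : @weakEquivalences C _ M₁.categoryWithWeakEquivalences =
      @weakEquivalences C _ M₂.categoryWithWeakEquivalences) : M₁ = M₂ := by
  have h₃ : @fibrations C _ M₁.categoryWithFibrations =
      @fibrations C _ M₂.categoryWithFibrations := by
    rw [@fibrations_eq_rlp C _ M₁, @fibrations_eq_rlp C _ M₂, h₁, h₂]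
  obtain @⟨⟨F₁⟩, ⟨L₁⟩, ⟨W₁⟩, _⟩ := M₁
  obtain @⟨⟨F₂⟩, ⟨L₂⟩, ⟨W₂⟩, _⟩ := M₂
  obtain rfl : F₁ = F₂ := h₃
  obtain rfl : L₁ = L₂ := h₁
  obtain rfl : W₁ = W₂ := h₂
  rfl

end ModelCategory

end DirectedCylinder

theorem mainTheorem1 {C : Type u} [Category.{v} C] [IsLocallyPresentable.{v} C]
    (L R : MorphismProperty C)
    (hLR : DirectedCylinder.IsCofibrantlyGeneratedWFS L R)
    (hcof : ∀ X : C, L (initial.to X))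
    (cyl : DirectedCylinder.FunctorialCylinder L) (hcyl : cyl.IsExact)
    (An : MorphismProperty C) (hAn : cyl.IsRightAnodyneClass An) :
    (∃! _M : ModelCategory C,
      cofibrations C = L ∧
      weakEquivalences C = DirectedCylinder.rightEquivalences cyl An) ∧
    (∀ _M : ModelCategory C,
      cofibrations C = L →
      weakEquivalences C = DirectedCylinder.rightEquivalences cyl An →
      (∀ X : C, IsFibrant X ↔ DirectedCylinder.IsRightFibrant An X) ∧
      (∀ (X Y : C) (f : X ⟶ Y), DirectedCylinder.IsRightFibrant An X →
        DirectedCylinder.IsRightFibrant An Y →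
        (Fibration f ↔ DirectedCylinder.rightFibrations An f))) := by
  have := hLR.isWFS
  obtain rfl : L.rlp = R := MorphismProperty.rlp_eq_of_wfs L R
  obtain ⟨S, _, hS⟩ := hLR.exists_generators
  have hRW := DirectedCylinder.FunctorialCylinder.rlp_le_rightEquivalences
    (cyl := cyl) (An := An) hcof
  have := hAn.hasFactorization_rlp
  have hL : L.rlp.llp = L := MorphismProperty.llp_eq_of_wfs L L.rlp
  have : L.IsStableUnderComposition := by rw [← hL]; infer_instance
  have hLW : (L ⊓ DirectedCylinder.rightEquivalences cyl An).rlp.llp =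
      L ⊓ DirectedCylinder.rightEquivalences cyl An := by
    rw [hAn.inf_rightEquivalences_eq_llp hcof hcyl hL, MorphismProperty.llp_rlp_llp]
  have := (hAn.solutionSetCondition hcof hcyl hS).hasFactorization hS hRW hLW
  have hfib (X Y : C) (f : X ⟶ Y) (hX : DirectedCylinder.IsRightFibrant An X)
      (hY : DirectedCylinder.IsRightFibrant An Y) :
      (L ⊓ DirectedCylinder.rightEquivalences cyl An).rlp f ↔
        DirectedCylinder.rightFibrations An f :=
    ⟨fun hf _ _ i hi ↦ hf _ ⟨hAn.le _ hi, hAn.le_rightEquivalences hcyl _ hi⟩,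
      fun hf _ _ i hi ↦ (hAn.rightEquivalences_iff hcof hcyl hi.1).1 hi.2 _ ⟨hX, hY, hf⟩⟩
  refine ⟨⟨DirectedCylinder.modelCategoryOfWFS L _ hRW hLW, ⟨rfl, rfl⟩, fun M hM ↦
    DirectedCylinder.modelCategory_ext _ _ hM.1 hM.2⟩, fun M h₁ h₂ ↦ ?_⟩
  have hM : fibrations C = (L ⊓ DirectedCylinder.rightEquivalences cyl An).rlp := by
    rw [DirectedCylinder.fibrations_eq_rlp, h₁, h₂]
  refine ⟨fun X ↦ ?_, fun X Y f hX hY ↦ ?_⟩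
  · rw [isFibrant_iff, fibration_iff, hM]
    exact ⟨fun hf _ _ i hi ↦ hf _ ⟨hAn.le _ hi, hAn.le_rightEquivalences hcyl _ hi⟩,
      fun hX ↦ (hfib _ _ _ hX (DirectedCylinder.isRightFibrant_terminal An)).2 hX⟩
  · rw [fibration_iff, hM]
    exact hfib _ _ _ hX hY
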